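/- Let $m\ge 0$ be an integer, let $d>0$, let $\mathscr D_d=\{\zeta\in\mathbb C:|\operatorname{Im}\zeta|<d\}$, and let $-\infty\le a<b\le\infty$. Let $\phi$ be a conformal map (a holomorphic bijection, with nonvanishing derivative) of $\mathscr D_d$ onto a complex domain $\mathscr D$ containing $(a,b)$, such that $\phi^{-1}(t)$ is real for all $t\in(a,b)$. Let $f,g:\mathscr D\to\mathbb C$, where $g$ has no zero in $\mathscr D$ and its restriction to $(a,b)$ is $m$ times continuously differentiable, and let $F(\zeta)=f(\phi(\zeta))/g(\phi(\zeta))$ for $\zeta\in\mathscr D_d$. Let $\mathbf H^1(\mathscr D_d)$ denote the family of all analytic functions $F$ on $\mathscr D_d$ for which the limit $$\mathcal N_1(F,d)=\lim_{\epsilon\to 0+}\oint_{\partial\mathscr D_d(\epsilon)}|F(\zeta)|\,|\mathrm d\zeta|,\qquad \mathscr D_d(\epsilon)=\{\zeta\in\mathbb C:|\operatorname{Re}\zeta|<1/\epsilon,\ |\operatorname{Im}\zeta|<d(1-\epsilon)\},$$ exists and is finite, and let $S(k,h)(x)=\dfrac{\sin[\pi(x-kh)/h]}{\pi(x-kh)/h}$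 for $x\ne kh$, $S(k,h)(kh)=1$. Assume that $F\in\mathbf H^1(\mathscr D_d)$. Then $f$ is $m$ times continuously differentiable on $(a,b)$. Moreover, for every constant $\tilde C_1>0$ there is a constant $\tilde C_2$, independent of $h$, such that the following holds for every $h>0$. If, for all $j=0,1,\dots,m$ and all nonnegative integers $\lambda_0,\dots,\lambda_j$ with $\lambda_0=0$ and $\sum_{l=1}^{j}l\lambda_l=j$, $$\sup_{t\in(a,b),\ s\in[-\pi/h,\pi/h]}\left|\left(\frac{\partial}{\partial t}\right)^{m-j}\left\{g(t)e^{is\phi^{-1}(t)}\right\}\prod_{l=0}^{j}\left[(\phi^{-1})^{(l)}(t)\right]^{\lambda_l}\right|\le\tilde C_1h^{-m},$$ then the series below converges absolutely for every $t\in(a,b)$, and $$\sup_{t\in(a,b)}\left|f^{(m)}(t)-\sum_{k=-\infty}^{\infty}\frac{f(\phi(kh))}{g(\phi(kh))}\left(\frac{\mathrm d}{\mathrm dt}\right)^m\left\{g(t)\,S(k,h)(\phi^{-1}(t))\right\}\right|\le\frac{\tilde C_2\,\mathcal N_1(F,d)}{h^m\sinh(\pi d/h)}.$$ -/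

import Mathlib

open Filter Topology

noncomputable section

namespace SincDeriv

/-- The strip `{ζ : |Im ζ| < d}`. -/
def strip (d : ℝ) : Set ℂ := {ζ | |ζ.im| < d}

/-- The real points `t` of the open interval `(a, b)`, whose end points may be infinite. -/
def openInterval (a b : EReal) : Set ℝ := {t | a < (t : EReal) ∧ (t : EReal) < b}

/-- `φ` is a conformal map of `U` onto `V`: holomorphic on `U` with nowhere vanishing derivative,
and a bijection from `U` onto `V`. -/
structure IsConformalOnto (φ : ℂ → ℂ) (U V : Set ℂ) : Prop where
  analytic : AnalyticOnNhd ℂ φ U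
  deriv_ne_zero : ∀ ζ ∈ U, deriv φ ζ ≠ 0
  bijOn : Set.BijOn φ U V

/-- The real-variable function `t ↦ φ⁻¹(t)`, where `φ⁻¹` is the inverse of `φ` restricted to `U`. -/
def inverseOn (φ : ℂ → ℂ) (U : Set ℂ) (t : ℝ) : ℂ := Function.invFunOn φ U (t : ℂ)

/-- The integral of `|F|` with respect to arc length over the boundary of the rectangle
`{ζ : |Re ζ| < 1/ε, |Im ζ| < d (1 - ε)}`. -/
def boundaryIntegral (F : ℂ → ℂ) (d ε : ℝ) : ℝ :=
  (∫ x in (-(1 / ε))..(1 / ε), ‖F (x - (d * (1 - ε) : ℝ) * Complex.I)‖) +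
  (∫ x in (-(1 / ε))..(1 / ε), ‖F (x + (d * (1 - ε) : ℝ) * Complex.I)‖) +
  (∫ y in (-(d * (1 - ε)))..(d * (1 - ε)), ‖F (-(1 / ε : ℝ) + y * Complex.I)‖) +
  (∫ y in (-(d * (1 - ε)))..(d * (1 - ε)), ‖F ((1 / ε : ℝ) + y * Complex.I)‖)

/-- `𝒩₁(F, d)`, the limit of the boundary integrals as `ε` decreases to `0`
(it is used only for `F` in `hardyH1 d`, where the limit exists). -/
def hardyNorm (F : ℂ → ℂ) (d : ℝ) : ℝ :=
  limUnder (𝓝[>] (0 : ℝ)) (boundaryIntegral F d)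

/-- The space `𝐇¹` of the strip: the functions analytic on it for which the limit defining
`𝒩₁(F, d)` exists and is finite. -/
def hardyH1 (d : ℝ) : Set (ℂ → ℂ) :=
  {F | AnalyticOnNhd ℂ F (strip d) ∧
    ∃ N : ℝ, Tendsto (boundaryIntegral F d) (𝓝[>] (0 : ℝ)) (𝓝 N)}

/-- The Sinc function `S(k, h)`. -/
def sincFun (k : ℤ) (h : ℝ) (x : ℂ) : ℂ :=
  open scoped Classical in
  if x = k * h then 1
  else Complex.sin (Real.pi * (x - k * h) / h) / (Real.pi * (x - k * h) / h)

/-- The uniform bound by `C h⁻ᵐ`, over `t ∈ (a, b)` and `s ∈ [-π/h, π/h]`, on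
`(∂/∂t)^(m-j) {g(t) exp(i s φ⁻¹(t))} ∏_{l=0}^{j} [(φ⁻¹)^(l)(t)]^(lam l)`, for all `j = 0, …, m` and all
`lam` with `lam 0 = 0` and `∑_{l=1}^{j} l * lam l = j`; here `ψ` stands for `φ⁻¹`. -/
def DerivBound (g : ℂ → ℂ) (ψ : ℝ → ℂ) (a b : EReal) (m : ℕ) (C h : ℝ) : Prop :=
  ∀ j : ℕ, j ≤ m → ∀ lam : ℕ → ℕ, lam 0 = 0 → ∑ l ∈ Finset.Icc 1 j, l * lam l = j →
    ∀ t ∈ openInterval a b, ∀ s ∈ Set.Icc (-(Real.pi / h)) (Real.pi / h),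
      ‖iteratedDeriv (m - j) (fun τ : ℝ => g τ * Complex.exp (Complex.I * s * ψ τ)) t *
          ∏ l ∈ Finset.range (j + 1), (iteratedDeriv l ψ t) ^ lam l‖ ≤ C * (h ^ m)⁻¹

end SincDeriv

end

/-! Write `ψ` for the inverse of `φ`, so that `f = g * F(ψ)` on the interval; smoothness of `f` is
immediate. The error estimate is a contour argument for the truncated Sinc expansion, followed by `N
→ ∞`. The remainder `R_N = F - ∑_{|k| ≤ N} F(kh) S(k,h)` vanishes at the nodes, so `R_N = sin(π z/h)
P` with `P` holomorphic on `|Re z| < (N+1)h` in the strip (`exists_sincRemainder_factor`). Off the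
nodes, `2πi P(z)` is the integral of `F(ζ) / (sin(πζ/h)(ζ - z))` over the boundary of `[-A, A] ×
[-B, B]`, with `A = (N+1/2)h` (`rectIntegral_sincRemainder_factor`). The sine is at least
`sinh(πB/h)` in modulus on the horizontal sides, and at least `1` on the vertical ones, which recede
to infinity. This bounds `P` near a real point, and Cauchy's estimates bound its derivatives there.
Pulled back to the interval, the error is `(g sin(πψ/h)) * P(ψ)`. Leibniz and the chain rule express
its `m`-th derivative through derivatives of `P` at `ψ t` and the products controlled by
`DerivBound`, the sine being a combination of `exp(± iπψ/h)`. Taking `B = d(1 - 1/A)` makes the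
contour the one of `boundaryIntegral` with `ε = 1/A`, so the bound tends to the stated one. Absolute
convergence rests on the summability of `|F(kh)|` (`summable_samples`). -/

noncomputable section

namespace SincDeriv

/-! ### Contour integration over rectangles centred at the origin -/

/-- The boundary of the closed rectangle `[-A, A] × [-B, B]`. -/
def rectBoundary (A B : ℝ) : Set ℂ :=
  {z | |z.re| ≤ A ∧ |z.im| ≤ B ∧ (|z.re| = A ∨ |z.im| = B)}

/-- The counterclockwise contour integral over the boundary of `[-A, A] × [-B, B]`. -/
def rectIntegral (f : ℂ → ℂ) (A B : ℝ) : ℂ :=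
  (∫ x : ℝ in (-A)..A, f (x - B * Complex.I)) - (∫ x : ℝ in (-A)..A, f (x + B * Complex.I)) +
    Complex.I * (∫ y : ℝ in (-B)..B, f (A + y * Complex.I)) -
    Complex.I * (∫ y : ℝ in (-B)..B, f (-A + y * Complex.I))

/-- The integral of `|F|` over the boundary of `[-A, A] × [-B, B]`. -/
def rectNorm (F : ℂ → ℂ) (A B : ℝ) : ℝ :=
  (∫ x : ℝ in (-A)..A, ‖F (x - B * Complex.I)‖) + (∫ x : ℝ in (-A)..A, ‖F (x + B * Complex.I)‖) +
    (∫ y : ℝ in (-B)..B, ‖F (-A + y * Complex.I)‖) + (∫ y : ℝ in (-B)..B, ‖F (A + y * Complex.I)‖)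

theorem boundaryIntegral_eq_rectNorm (F : ℂ → ℂ) (d ε : ℝ) :
    boundaryIntegral F d ε = rectNorm F (1 / ε) (d * (1 - ε)) := rfl

section

variable {A B : ℝ}

theorem bottom_mem (hB : 0 ≤ B) {x : ℝ} (hx : x ∈ Set.Icc (-A) A) :
    (x - B * Complex.I : ℂ) ∈ rectBoundary A B := by
  simp [rectBoundary, abs_le, hx.1, hx.2, abs_of_nonneg hB, hB]

theorem top_mem (hB : 0 ≤ B) {x : ℝ} (hx : x ∈ Set.Icc (-A) A) :
    (x + B * Complex.I : ℂ) ∈ rectBoundary A B := by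
  simp [rectBoundary, abs_le, hx.1, hx.2, abs_of_nonneg hB, hB]

theorem left_mem (hA : 0 ≤ A) {y : ℝ} (hy : y ∈ Set.Icc (-B) B) :
    (-A + y * Complex.I : ℂ) ∈ rectBoundary A B := by
  simp [rectBoundary, abs_le, hy.1, hy.2, abs_of_nonneg hA, hA]

theorem right_mem (hA : 0 ≤ A) {y : ℝ} (hy : y ∈ Set.Icc (-B) B) :
    (A + y * Complex.I : ℂ) ∈ rectBoundary A B := by
  simp [rectBoundary, abs_le, hy.1, hy.2, abs_of_nonneg hA, hA]

theorem continuousOn_sides {E : Type*} [TopologicalSpace E] {f : ℂ → E} (hA : 0 ≤ A) (hB : 0 ≤ B)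
    (hf : ContinuousOn f (rectBoundary A B)) :
    ContinuousOn (fun x : ℝ => f (x - B * Complex.I)) (Set.Icc (-A) A) ∧
    ContinuousOn (fun x : ℝ => f (x + B * Complex.I)) (Set.Icc (-A) A) ∧
    ContinuousOn (fun y : ℝ => f (-A + y * Complex.I)) (Set.Icc (-B) B) ∧
    ContinuousOn (fun y : ℝ => f (A + y * Complex.I)) (Set.Icc (-B) B) := by
  refine ⟨hf.comp (by fun_prop) fun x hx => bottom_mem hB hx,
    hf.comp (by fun_prop) fun x hx => top_mem hB hx,
    hf.comp (by fun_prop) fun x hx => left_mem hA hx,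
    hf.comp (by fun_prop) fun x hx => right_mem hA hx⟩

theorem rectIntegral_congr {f g : ℂ → ℂ} (hA : 0 ≤ A) (hB : 0 ≤ B)
    (h : Set.EqOn f g (rectBoundary A B)) : rectIntegral f A B = rectIntegral g A B := by
  have hA' : -A ≤ A := by linarith
  have hB' : -B ≤ B := by linarith
  unfold rectIntegral
  congr 1
  · congr 1
    · congr 1 <;> refine intervalIntegral.integral_congr fun x hx => ?_ <;>
        rw [Set.uIcc_of_le hA'] at hx
      · exact h (bottom_mem hB hx)
      · exact h (top_mem hB hx)
    · congr 1
      refine intervalIntegral.integral_congr fun x hx => ?_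
      rw [Set.uIcc_of_le hB'] at hx
      exact h (right_mem hA hx)
  · congr 1
    refine intervalIntegral.integral_congr fun x hx => ?_
    rw [Set.uIcc_of_le hB'] at hx
    exact h (left_mem hA hx)

theorem rectIntegral_const_mul (c : ℂ) (f : ℂ → ℂ) :
    rectIntegral (fun ζ => c * f ζ) A B = c * rectIntegral f A B := by
  simp only [rectIntegral, intervalIntegral.integral_const_mul]
  ring

theorem rectIntegral_add {f g : ℂ → ℂ} (hA : 0 ≤ A) (hB : 0 ≤ B)
    (hf : ContinuousOn f (rectBoundary A B)) (hg : ContinuousOn g (rectBoundary A B)) :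
    rectIntegral (fun ζ => f ζ + g ζ) A B = rectIntegral f A B + rectIntegral g A B := by
  have hA' : -A ≤ A := by linarith
  have hB' : -B ≤ B := by linarith
  obtain ⟨f1, f2, f3, f4⟩ := continuousOn_sides hA hB hf
  obtain ⟨g1, g2, g3, g4⟩ := continuousOn_sides hA hB hg
  unfold rectIntegral
  rw [intervalIntegral.integral_add (f1.intervalIntegrable_of_Icc hA')
      (g1.intervalIntegrable_of_Icc hA'),
    intervalIntegral.integral_add (f2.intervalIntegrable_of_Icc hA')
      (g2.intervalIntegrable_of_Icc hA'),
    intervalIntegral.integral_add (f3.intervalIntegrable_of_Icc hB')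
      (g3.intervalIntegrable_of_Icc hB'),
    intervalIntegral.integral_add (f4.intervalIntegrable_of_Icc hB')
      (g4.intervalIntegrable_of_Icc hB')]
  ring

theorem rectIntegral_sum {ι : Type*} (s : Finset ι) {f : ι → ℂ → ℂ} (hA : 0 ≤ A) (hB : 0 ≤ B)
    (hf : ∀ i ∈ s, ContinuousOn (f i) (rectBoundary A B)) :
    rectIntegral (fun ζ => ∑ i ∈ s, f i ζ) A B = ∑ i ∈ s, rectIntegral (f i) A B := by
  classical
  induction s using Finset.induction_on with
  | empty => simp [rectIntegral]
  | insert i s hi ih =>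
    simp only [Finset.sum_insert hi]
    rw [rectIntegral_add hA hB (hf i (Finset.mem_insert_self i s))
      (continuousOn_finsetSum s fun k hk => hf k (Finset.mem_insert_of_mem hk)),
      ih fun k hk => hf k (Finset.mem_insert_of_mem hk)]

theorem norm_rectIntegral_le {F f : ℂ → ℂ} {M : ℝ} (hA : 0 ≤ A) (hB : 0 ≤ B)
    (hF : ContinuousOn F (rectBoundary A B))
    (h : ∀ ζ ∈ rectBoundary A B, ‖f ζ‖ ≤ M * ‖F ζ‖) :
    ‖rectIntegral f A B‖ ≤ M * rectNorm F A B := by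
  have hA' : -A ≤ A := by linarith
  have hB' : -B ≤ B := by linarith
  obtain ⟨f1, f2, f3, f4⟩ := continuousOn_sides hA hB hF
  have key : ∀ {a : ℝ} (p : ℝ → ℂ), -a ≤ a →
      ContinuousOn (fun x => F (p x)) (Set.Icc (-a) a) →
      (∀ x ∈ Set.Icc (-a) a, p x ∈ rectBoundary A B) →
      ‖∫ x in (-a)..a, f (p x)‖ ≤ M * ∫ x in (-a)..a, ‖F (p x)‖ := by
    intro a p ha hc hp
    rw [← intervalIntegral.integral_const_mul]
    refine intervalIntegral.norm_integral_le_of_norm_le ha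
      (Eventually.of_forall fun x hx => h _ (hp x (Set.Ioc_subset_Icc_self hx))) ?_
    exact (continuousOn_const.mul hc.norm).intervalIntegrable_of_Icc ha
  have k1 := key _ hA' f1 fun x hx => bottom_mem hB hx
  have k2 := key _ hA' f2 fun x hx => top_mem hB hx
  have k3 := key _ hB' f3 fun x hx => left_mem hA hx
  have k4 := key _ hB' f4 fun x hx => right_mem hA hx
  unfold rectIntegral rectNorm
  refine (norm_sub_le _ _).trans ?_
  refine (add_le_add (norm_add_le _ _) le_rfl).trans ?_
  refine (add_le_add (add_le_add (norm_sub_le _ _) le_rfl) le_rfl).trans ?_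
  simp only [norm_mul, Complex.norm_I, one_mul]
  linarith

theorem rectIntegral_eq_zero {f : ℂ → ℂ} (hA : 0 ≤ A) (hB : 0 ≤ B)
    (hf : DifferentiableOn ℂ f {z | |z.re| ≤ A ∧ |z.im| ≤ B}) : rectIntegral f A B = 0 := by
  have := Complex.integral_boundary_rect_eq_zero_of_differentiableOn f (-A - B * Complex.I)
    (A + B * Complex.I) (by
      refine hf.mono fun z hz => ?_
      simp only [Complex.mem_reProdIm] at hz
      simp at hz
      rw [Set.uIcc_of_le (by linarith), Set.uIcc_of_le (by linarith)] at hz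
      exact ⟨abs_le.2 hz.1, abs_le.2 hz.2⟩)
  simp at this
  simp only [rectIntegral]
  simpa [sub_eq_add_neg] using this

theorem log_I_mul {u : ℂ} (hu : 0 < u.re) :
    Complex.log (Complex.I * u) = Complex.log u + Real.pi / 2 * Complex.I := by
  have h0 : u ≠ 0 := by rintro rfl; simp at hu
  have h1 := abs_lt.1 ((Complex.abs_arg_lt_pi_div_two_iff).2 (Or.inl hu))
  rw [(Complex.log_mul_eq_add_log_iff Complex.I_ne_zero h0).2, Complex.log_I, add_comm]
  rw [Complex.arg_I]
  constructor <;> linarith [Real.pi_pos, h1.1, h1.2]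

/-- The factor `c` rotates the segment into the right half-plane, where the principal logarithm is
an antiderivative. -/
theorem integral_inv_eq_log {a b : ℝ} {c v w : ℂ} (hc : c ≠ 0)
    (h : ∀ x ∈ Set.uIcc a b, 0 < (c * (v * x + w)).re) :
    ∫ x : ℝ in a..b, v * (v * x + w)⁻¹ =
      Complex.log (c * (v * b + w)) - Complex.log (c * (v * a + w)) := by
  have hne : ∀ x ∈ Set.uIcc a b, v * (x : ℂ) + w ≠ 0 := by
    intro x hx h0
    have := h x hx
    simp [h0] at this
  refine intervalIntegral.integral_eq_sub_of_hasDerivAt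
    (f := fun x : ℝ => Complex.log (c * (v * x + w))) (fun x hx => ?_) ?_
  · have h1 : HasDerivAt (fun x : ℝ => c * (v * x + w)) (c * v) x := by
      have := (((Complex.ofRealCLM.hasDerivAt (x := x)).const_mul v).add_const w).const_mul c
      simpa using this
    refine (h1.clog_real (Or.inl (h x hx))).congr_deriv ?_
    rw [mul_div_mul_left _ _ hc, div_eq_mul_inv]
  · refine ContinuousOn.intervalIntegrable ?_
    exact continuousOn_const.mul (ContinuousOn.inv₀ (by fun_prop) hne)

/-- Each side uses a logarithm rotated by one of `±1`, `±I`. At every corner the two adjacent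
branches differ by `πi/2` (`log_I_mul`), and the four jumps add up to `2πi`. -/
theorem rectIntegral_inv_sub {z : ℂ} (h1 : |z.re| < A) (h2 : |z.im| < B) :
    rectIntegral (fun ζ => (ζ - z)⁻¹) A B = 2 * Real.pi * Complex.I := by
  rw [abs_lt] at h1 h2
  have hb := integral_inv_eq_log (a := -A) (b := A) (c := Complex.I) (v := 1)
    (w := -B * Complex.I - z) Complex.I_ne_zero (by
      intro x hx; simp; linarith)
  have ht := integral_inv_eq_log (a := -A) (b := A) (c := -Complex.I) (v := 1)
    (w := B * Complex.I - z) (neg_ne_zero.2 Complex.I_ne_zero) (by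
      intro x hx; simp; linarith)
  have hr := integral_inv_eq_log (a := -B) (b := B) (c := 1) (v := Complex.I)
    (w := A - z) one_ne_zero (by
      intro x hx; simp; linarith)
  have hl := integral_inv_eq_log (a := -B) (b := B) (c := -1) (v := Complex.I)
    (w := -A - z) (neg_ne_zero.2 one_ne_zero) (by
      intro x hx; simp; linarith)
  have c1 := log_I_mul (u := A - B * Complex.I - z) (by simp; linarith)
  have c2 := log_I_mul (u := -Complex.I * (A + B * Complex.I - z)) (by simp; linarith)
  have c3 := log_I_mul (u := -(-A + B * Complex.I - z)) (by simp; linarith)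
  have c4 := log_I_mul (u := Complex.I * (-A - B * Complex.I - z)) (by simp; linarith)
  have e1 : ∀ w : ℂ, Complex.I * (-Complex.I * w) = w := fun w => by
    linear_combination (-w) * Complex.I_sq
  have e2 : ∀ w : ℂ, Complex.I * (Complex.I * w) = -w := fun w => by
    linear_combination w * Complex.I_sq
  rw [e1] at c2
  rw [e2] at c4
  simp only [rectIntegral]
  rw [← intervalIntegral.integral_const_mul, ← intervalIntegral.integral_const_mul]
  have g1 : ∀ x : ℝ, (x - B * Complex.I - z : ℂ)⁻¹ = 1 * (1 * x + (-B * Complex.I - z))⁻¹ :=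
    fun x => by ring_nf
  have g2 : ∀ x : ℝ, (x + B * Complex.I - z : ℂ)⁻¹ = 1 * (1 * x + (B * Complex.I - z))⁻¹ :=
    fun x => by ring_nf
  have g3 : ∀ x : ℝ, (A + x * Complex.I - z : ℂ)⁻¹ = (Complex.I * x + (A - z))⁻¹ :=
    fun x => by ring_nf
  have g4 : ∀ x : ℝ, (-A + x * Complex.I - z : ℂ)⁻¹ = (Complex.I * x + (-A - z))⁻¹ :=
    fun x => by ring_nf
  simp only [g1, g2, g3, g4]
  rw [hb, ht, hr, hl]
  push_cast
  have n1 : Complex.I * (1 * (A : ℂ) + (-B * Complex.I - z)) =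
    Complex.I * (A - B * Complex.I - z) := by ring
  have n2 : Complex.I * (1 * (-A : ℂ) + (-B * Complex.I - z)) =
    Complex.I * (-A - B * Complex.I - z) := by ring
  have n3 : -Complex.I * (1 * (A : ℂ) + (B * Complex.I - z)) =
    -Complex.I * (A + B * Complex.I - z) := by ring
  have n4 : -Complex.I * (1 * (-A : ℂ) + (B * Complex.I - z)) =
    Complex.I * -(-A + B * Complex.I - z) := by ring
  have n5 : 1 * (Complex.I * (B : ℂ) + (A - z)) = A + B * Complex.I - z := by ring
  have n6 : 1 * (Complex.I * (-B : ℂ) + (A - z)) = A - B * Complex.I - z := by ring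
  have n7 : -1 * (Complex.I * (B : ℂ) + (-A - z)) = -(-A + B * Complex.I - z) := by ring
  have n8 : -1 * (Complex.I * (-B : ℂ) + (-A - z)) = -(-A - B * Complex.I - z) := by ring
  rw [n1, n2, n3, n4, n5, n6, n7, n8, c1, c2, c3, c4]
  ring

theorem ne_of_mem_rectBoundary {z ζ : ℂ} (h1 : |z.re| < A) (h2 : |z.im| < B)
    (hζ : ζ ∈ rectBoundary A B) : ζ ≠ z := by
  rintro rfl
  rcases hζ.2.2 with h | h <;> linarith

theorem continuousOn_inv_sub {z : ℂ} (h1 : |z.re| < A) (h2 : |z.im| < B) :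
    ContinuousOn (fun ζ => (ζ - z)⁻¹) (rectBoundary A B) :=
  ContinuousOn.inv₀ (by fun_prop) fun _ hζ => sub_ne_zero.2 (ne_of_mem_rectBoundary h1 h2 hζ)

theorem continuousOn_const_mul_inv_sub (c : ℂ) {z : ℂ} (h1 : |z.re| < A) (h2 : |z.im| < B) :
    ContinuousOn (fun ζ => c * (ζ - z)⁻¹) (rectBoundary A B) :=
  continuousOn_const.mul (continuousOn_inv_sub h1 h2)

/-- Subtracting `Q z / (ζ - z)` leaves the difference quotient `dslope Q z`, which is holomorphic
and integrates to zero. -/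
theorem rectIntegral_cauchy {Q : ℂ → ℂ} {U : Set ℂ} (hU : IsOpen U)
    (hAU : {z : ℂ | |z.re| ≤ A ∧ |z.im| ≤ B} ⊆ U) (hQ : DifferentiableOn ℂ Q U) {z : ℂ}
    (h1 : |z.re| < A) (h2 : |z.im| < B) :
    rectIntegral (fun ζ => Q ζ * (ζ - z)⁻¹) A B = 2 * Real.pi * Complex.I * Q z := by
  have hA : 0 ≤ A := (abs_nonneg _).trans h1.le
  have hB : 0 ≤ B := (abs_nonneg _).trans h2.le
  have hd : DifferentiableOn ℂ (dslope Q z) U :=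
    (Complex.differentiableOn_dslope (hU.mem_nhds (hAU ⟨h1.le, h2.le⟩))).2 hQ
  have hd' := hd.mono hAU
  have h0 := rectIntegral_eq_zero hA hB hd'
  have hsub : rectBoundary A B ⊆ {z : ℂ | |z.re| ≤ A ∧ |z.im| ≤ B} := fun ζ h => ⟨h.1, h.2.1⟩
  have heq : rectIntegral (fun ζ => Q ζ * (ζ - z)⁻¹) A B =
      rectIntegral (fun ζ => dslope Q z ζ + Q z * (ζ - z)⁻¹) A B := by
    refine rectIntegral_congr hA hB fun ζ hζ => ?_
    have hne := ne_of_mem_rectBoundary h1 h2 hζ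
    simp only [dslope_of_ne _ hne, slope_def_field]
    have := sub_ne_zero.2 hne
    field_simp
    ring
  rw [heq, rectIntegral_add hA hB (hd'.continuousOn.mono hsub)
    (continuousOn_const_mul_inv_sub _ h1 h2), h0, rectIntegral_const_mul,
    rectIntegral_inv_sub h1 h2]
  ring

/-- By partial fractions the residues at the two enclosed poles cancel. This removes the node terms
from the integral for the remainder. -/
theorem rectIntegral_inv_mul_inv {p z : ℂ} (hpz : p ≠ z) (h1 : |z.re| < A) (h2 : |z.im| < B)
    (h3 : |p.re| < A) (h4 : |p.im| < B) :
    rectIntegral (fun ζ => (ζ - p)⁻¹ * (ζ - z)⁻¹) A B = 0 := by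
  have hA : 0 ≤ A := (abs_nonneg _).trans h1.le
  have hB : 0 ≤ B := (abs_nonneg _).trans h2.le
  have heq : rectIntegral (fun ζ => (ζ - p)⁻¹ * (ζ - z)⁻¹) A B =
      rectIntegral (fun ζ => (z - p)⁻¹ * (ζ - z)⁻¹ + (-(z - p)⁻¹) * (ζ - p)⁻¹) A B := by
    refine rectIntegral_congr hA hB fun ζ hζ => ?_
    have e1 := sub_ne_zero.2 (ne_of_mem_rectBoundary h1 h2 hζ)
    have e2 := sub_ne_zero.2 (ne_of_mem_rectBoundary h3 h4 hζ)
    have e3 := sub_ne_zero.2 hpz.symm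
    field_simp
    ring
  rw [heq, rectIntegral_add hA hB (continuousOn_const_mul_inv_sub _ h1 h2)
    (continuousOn_const_mul_inv_sub _ h3 h4), rectIntegral_const_mul,
    rectIntegral_const_mul, rectIntegral_inv_sub h1 h2, rectIntegral_inv_sub h3 h4]
  ring

end

/-! ### Higher derivatives of products with compositions -/

/-- A Faà di Bruno bound without its coefficients: the multisets `S` are the partitions of `j`. The
weight `G` makes the induction close: Leibniz applied to `Q'(ψ) ψ'` produces one derivative of `ψ`,
which is moved into the weight. -/
theorem exists_norm_iteratedDeriv_comp_le (j : ℕ) : ∃ K : ℝ, 0 ≤ K ∧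
    ∀ (ψ : ℝ → ℂ) (t : ℝ), ContDiffAt ℝ (⊤ : ℕ∞) ψ t → ∀ (Q : ℂ → ℂ), AnalyticAt ℂ Q (ψ t) →
    ∀ M : ℝ, (∀ p ≤ j, ‖iteratedDeriv p Q (ψ t)‖ ≤ M) →
    ∀ G B : ℝ, 0 ≤ G →
    (∀ S : Multiset ℕ, (∀ l ∈ S, 1 ≤ l) → S.sum = j →
      G * (S.map fun l => ‖iteratedDeriv l ψ t‖).prod ≤ B) →
    G * ‖iteratedDeriv j (fun τ => Q (ψ τ)) t‖ ≤ K * M * B := by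
  induction j using Nat.strong_induction_on with
  | _ j ih =>
  rcases j with _ | j
  · refine ⟨1, zero_le_one, fun ψ t _ Q _ M hM G B hG hB => ?_⟩
    have h1 := hM 0 le_rfl
    have h2 := hB 0 (by simp) (by simp)
    simp only [iteratedDeriv_zero, Multiset.map_zero, Multiset.prod_zero, mul_one] at h1 h2 ⊢
    calc G * ‖Q (ψ t)‖ ≤ B * M := mul_le_mul h2 h1 (norm_nonneg _) (hG.trans h2)
      _ = 1 * M * B := by ring
  choose! K hK0 hK using ih
  refine ⟨∑ i ∈ Finset.range (j + 1), (j.choose i : ℝ) * K i,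
    Finset.sum_nonneg fun i hi => mul_nonneg (Nat.cast_nonneg _)
      (hK0 i (Finset.mem_range.1 hi)), fun ψ t hψ Q hQ M hM G B hG hB => ?_⟩
  have hderiv : deriv (fun τ => Q (ψ τ)) =ᶠ[𝓝 t] fun τ => deriv Q (ψ τ) * deriv ψ τ := by
    have h1 : ∀ᶠ τ in 𝓝 t, DifferentiableAt ℝ ψ τ :=
      ((hψ.of_le (m := 1) (by exact_mod_cast le_top)).eventually (by simp)).mono
        fun τ h => h.differentiableAt (by simp)
    have h2 : ∀ᶠ τ in 𝓝 t, AnalyticAt ℂ Q (ψ τ) :=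
      hψ.continuousAt.eventually hQ.eventually_analyticAt
    filter_upwards [h1, h2] with τ h1 h2
    have := (h2.differentiableAt.hasDerivAt.comp_of_eq τ h1.hasDerivAt rfl).deriv
    exact this
  have hψ' : ContDiffAt ℝ j (deriv ψ) t :=
    ContDiffAt.derivWithin hψ (by exact_mod_cast le_top)
  have hQ' : ContDiffAt ℝ j (fun τ => deriv Q (ψ τ)) t :=
    (hQ.deriv.contDiffAt.restrict_scalars ℝ).comp t (hψ.of_le (by exact_mod_cast le_top))
  rw [iteratedDeriv_succ', hderiv.iteratedDeriv_eq, iteratedDeriv_fun_mul hQ' hψ']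
  calc G * ‖∑ i ∈ Finset.range (j + 1), (j.choose i : ℂ) *
        iteratedDeriv i (fun τ => deriv Q (ψ τ)) t * iteratedDeriv (j - i) (deriv ψ) t‖
      ≤ G * ∑ i ∈ Finset.range (j + 1), (j.choose i : ℝ) *
        ‖iteratedDeriv i (fun τ => deriv Q (ψ τ)) t‖ * ‖iteratedDeriv (j - i + 1) ψ t‖ := by
        refine mul_le_mul_of_nonneg_left ((norm_sum_le _ _).trans_eq ?_) hG
        simp [iteratedDeriv_succ']
    _ = ∑ i ∈ Finset.range (j + 1), (j.choose i : ℝ) * ((G * ‖iteratedDeriv (j - i + 1) ψ t‖) *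
        ‖iteratedDeriv i (fun τ => deriv Q (ψ τ)) t‖) := by
        rw [Finset.mul_sum]
        exact Finset.sum_congr rfl fun i _ => by ring
    _ ≤ ∑ i ∈ Finset.range (j + 1), (j.choose i : ℝ) * (K i * M * B) := by
        refine Finset.sum_le_sum fun i hi => mul_le_mul_of_nonneg_left ?_ (Nat.cast_nonneg _)
        -- The new weight is `G * ‖ψ^(j-i+1)‖`; adjoining the part `j - i + 1` to a partition of `i`
        -- gives a partition of `j + 1`.
        have hij : i < j + 1 := Finset.mem_range.1 hi
        refine hK i hij ψ t hψ (deriv Q) hQ.deriv M (fun p hp => ?_) _ B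
          (mul_nonneg hG (norm_nonneg _)) fun S hS hSi => ?_
        · rw [← iteratedDeriv_succ']
          exact hM (p + 1) (by omega)
        · have := hB ((j - i + 1) ::ₘ S) (by
            intro l hl
            rcases Multiset.mem_cons.1 hl with rfl | hl
            · omega
            · exact hS l hl) (by rw [Multiset.sum_cons, hSi]; omega)
          simpa [mul_assoc] using this
    _ = (∑ i ∈ Finset.range (j + 1), (j.choose i : ℝ) * K i) * M * B := by
        rw [Finset.sum_mul, Finset.sum_mul]
        exact Finset.sum_congr rfl fun i _ => by ring

theorem exists_norm_iteratedDeriv_mul_comp_le (m : ℕ) : ∃ K : ℝ, 0 ≤ K ∧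
    ∀ (u ψ : ℝ → ℂ) (t : ℝ), ContDiffAt ℝ m u t → ContDiffAt ℝ (⊤ : ℕ∞) ψ t →
    ∀ (Q : ℂ → ℂ), AnalyticAt ℂ Q (ψ t) →
    ∀ M : ℝ, (∀ p ≤ m, ‖iteratedDeriv p Q (ψ t)‖ ≤ M) → ∀ B : ℝ,
    (∀ j ≤ m, ∀ S : Multiset ℕ, (∀ l ∈ S, 1 ≤ l) → S.sum = j →
      ‖iteratedDeriv (m - j) u t‖ * (S.map fun l => ‖iteratedDeriv l ψ t‖).prod ≤ B) →
    ‖iteratedDeriv m (fun τ => u τ * Q (ψ τ)) t‖ ≤ K * M * B := by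
  choose K hK0 hK using exists_norm_iteratedDeriv_comp_le
  refine ⟨∑ i ∈ Finset.range (m + 1), (m.choose i : ℝ) * K (m - i),
    Finset.sum_nonneg fun i _ => mul_nonneg (Nat.cast_nonneg _) (hK0 _),
    fun u ψ t hu hψ Q hQ M hM B hB => ?_⟩
  have hQ' : ContDiffAt ℝ m (fun τ => Q (ψ τ)) t :=
    (hQ.contDiffAt.restrict_scalars ℝ).comp t (hψ.of_le (by exact_mod_cast le_top))
  rw [iteratedDeriv_fun_mul hu hQ']
  calc _ ≤ ∑ i ∈ Finset.range (m + 1), (m.choose i : ℝ) *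
        (‖iteratedDeriv i u t‖ * ‖iteratedDeriv (m - i) (fun τ => Q (ψ τ)) t‖) := by
        refine (norm_sum_le _ _).trans_eq ?_
        simp [mul_assoc]
    _ ≤ ∑ i ∈ Finset.range (m + 1), (m.choose i : ℝ) * (K (m - i) * M * B) := by
        refine Finset.sum_le_sum fun i hi => mul_le_mul_of_nonneg_left ?_ (Nat.cast_nonneg _)
        have him : i < m + 1 := Finset.mem_range.1 hi
        refine hK (m - i) ψ t hψ Q hQ M (fun p hp => hM p (by omega)) _ B (norm_nonneg _)
          fun S hS hSi => ?_
        have := hB (m - i) (by omega) S hS hSi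
        rwa [show m - (m - i) = i by omega] at this
    _ = _ := by
        rw [Finset.sum_mul, Finset.sum_mul]
        exact Finset.sum_congr rfl fun i _ => by ring

/-- The exponents `lam l` are the multiplicities of the parts of `S`; all parts being positive gives
`lam 0 = 0`. -/
theorem DerivBound.multiset {g : ℂ → ℂ} {ψ : ℝ → ℂ} {a b : EReal} {m : ℕ} {C h : ℝ}
    (hD : DerivBound g ψ a b m C h) {j : ℕ} (hj : j ≤ m) {S : Multiset ℕ} (hS : ∀ l ∈ S, 1 ≤ l)
    (hSj : S.sum = j) {t : ℝ} (ht : t ∈ openInterval a b) {s : ℝ}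
    (hs : s ∈ Set.Icc (-(Real.pi / h)) (Real.pi / h)) :
    ‖iteratedDeriv (m - j) (fun τ : ℝ => g τ * Complex.exp (Complex.I * s * ψ τ)) t‖ *
      (S.map fun l => ‖iteratedDeriv l ψ t‖).prod ≤ C * (h ^ m)⁻¹ := by
  have hle : ∀ l ∈ S, l ≤ j := fun l hl => hSj ▸ Multiset.le_sum_of_mem hl
  have h0 : S.count 0 = 0 := Multiset.count_eq_zero.2 fun h => absurd (hS 0 h) (by omega)
  have hsum : ∑ l ∈ Finset.Icc 1 j, l * S.count l = j := by
    conv_rhs => rw [← hSj, Finset.sum_multiset_count]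
    simp only [smul_eq_mul, mul_comm]
    refine (Finset.sum_subset (fun l hl => ?_) fun l _ hl => ?_).symm
    · have hl' := Multiset.mem_toFinset.1 hl
      exact Finset.mem_Icc.2 ⟨hS l hl', hle l hl'⟩
    · rw [Multiset.count_eq_zero.2 fun h => hl (Multiset.mem_toFinset.2 h)]
      simp
  have := hD j hj (fun l => S.count l) h0 hsum t ht s hs
  rw [norm_mul, norm_prod] at this
  convert this using 2
  rw [Finset.prod_multiset_map_count]
  simp only [norm_pow]
  refine Finset.prod_subset (fun l hl => ?_) fun l _ hl => ?_
  · exact Finset.mem_range.2 (Nat.lt_succ_of_le (hle l (Multiset.mem_toFinset.1 hl)))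
  · rw [Multiset.count_eq_zero.2 fun h => hl (Multiset.mem_toFinset.2 h), pow_zero]

/-! ### Summability of the samples `F(kh)` -/

theorem summable_exp_neg_mul_sq {c : ℝ} (hc : 0 < c) :
    Summable fun n : ℤ => Real.exp (-(c * (n : ℝ) ^ 2)) := by
  have h : Summable fun n : ℕ => Real.exp (-(c * (n : ℝ) ^ 2)) := by
    refine Summable.of_nonneg_of_le (fun n => (Real.exp_pos _).le) (fun n => ?_)
      (Real.summable_exp_nat_mul_iff.2 (neg_lt_zero.2 hc))
    refine Real.exp_le_exp.2 ?_
    have : (n : ℝ) ≤ (n : ℝ) ^ 2 := by exact_mod_cast Nat.le_self_pow two_ne_zero n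
    nlinarith
  refine Summable.of_nat_of_neg ?_ ?_ <;> simpa using h

/-- With `u = h(θ + k₀)`, `0 ≤ θ ≤ 1` and `n = k - k₀`, one has `(θ - n)² ≥ n²/2 - θ² ≥ n²/2 - 1`,
so the sum is dominated by a Gaussian series not depending on `u`. -/
theorem exists_sum_exp_neg_sq_le {h : ℝ} (hh : 0 < h) : ∃ C : ℝ, 0 ≤ C ∧
    ∀ (u : ℝ) (s : Finset ℤ), ∑ k ∈ s, Real.exp (-(u - k * h) ^ 2) ≤ C := by
  have hsum := summable_exp_neg_mul_sq (c := h ^ 2 / 2) (by positivity)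
  refine ⟨Real.exp (h ^ 2) * ∑' n : ℤ, Real.exp (-(h ^ 2 / 2 * (n : ℝ) ^ 2)),
    mul_nonneg (Real.exp_pos _).le (tsum_nonneg fun _ => (Real.exp_pos _).le), fun u s => ?_⟩
  set k₀ : ℤ := ⌊u / h⌋
  calc ∑ k ∈ s, Real.exp (-(u - k * h) ^ 2)
      ≤ ∑ k ∈ s, Real.exp (h ^ 2) * Real.exp (-(h ^ 2 / 2 * ((k - k₀ : ℤ) : ℝ) ^ 2)) := by
        refine Finset.sum_le_sum fun k _ => ?_
        rw [← Real.exp_add]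
        refine Real.exp_le_exp.2 ?_
        obtain ⟨θ, hθ⟩ : ∃ θ, θ = u / h - k₀ := ⟨_, rfl⟩
        have h0 : 0 ≤ θ := hθ ▸ sub_nonneg.2 (Int.floor_le _)
        have h1 : θ ≤ 1 := by
          have := Int.lt_floor_add_one (u / h)
          rw [hθ]; linarith
        have hu : u = h * (θ + k₀) := by rw [hθ]; field_simp; ring
        have h2 : θ ^ 2 ≤ 1 := by nlinarith
        push_cast
        have e : h ^ 2 + -(h ^ 2 / 2 * ((k : ℝ) - k₀) ^ 2) - -(u - k * h) ^ 2 =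
            h ^ 2 * ((1 - θ ^ 2) + (2 * θ - ((k : ℝ) - k₀)) ^ 2 / 2) := by
          rw [hu]; ring
        have : 0 ≤ h ^ 2 * ((1 - θ ^ 2) + (2 * θ - ((k : ℝ) - k₀)) ^ 2 / 2) := by
          have : 0 ≤ 1 - θ ^ 2 := by linarith
          positivity
        linarith
    _ = Real.exp (h ^ 2) * ∑ k ∈ s, Real.exp (-(h ^ 2 / 2 * ((k - k₀ : ℤ) : ℝ) ^ 2)) :=
        (Finset.mul_sum _ _ _).symm
    _ ≤ _ := by
        refine mul_le_mul_of_nonneg_left ?_ (Real.exp_pos _).le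
        refine (((Equiv.subRight k₀).summable_iff.2 hsum).sum_le_tsum s
          fun _ _ => (Real.exp_pos _).le).trans_eq ?_
        exact (Equiv.subRight k₀).tsum_eq fun n : ℤ => Real.exp (-(h ^ 2 / 2 * (n : ℝ) ^ 2))

theorem isOpen_strip (d : ℝ) : IsOpen (strip d) :=
  isOpen_lt (by fun_prop) continuous_const

theorem rect_subset_strip {A B d : ℝ} (hB : B < d) :
    {z : ℂ | |z.re| ≤ A ∧ |z.im| ≤ B} ⊆ strip d := fun _ hz => hz.2.trans_lt hB

theorem rectBoundary_subset_strip {A B d : ℝ} (hB : B < d) : rectBoundary A B ⊆ strip d :=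
  fun _ hz => hz.2.1.trans_lt hB

/-- A finite sum of `|F(kh)|` is read off from a single Cauchy integral. The Gaussian factors equal
`1` at their own nodes and keep the kernel bounded uniformly in the number of nodes, so the integral
is at most a constant times the boundary norm of `F`. -/
theorem summable_samples {d h : ℝ} (hd : 0 < d) (hh : 0 < h) {F : ℂ → ℂ} (hF : F ∈ hardyH1 d) :
    Summable fun k : ℤ => ‖F (k * h)‖ := by
  obtain ⟨hFa, N, hN⟩ := hF
  obtain ⟨C, hC0, hC⟩ := exists_sum_exp_neg_sq_le hh
  -- Lower bound for the distance from the contour to the nodes: horizontal sides have height `B ≥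
  -- d/2`, and vertical ones are at distance at least `A/2 ≥ 1`.
  obtain ⟨δ, hδ⟩ : ∃ δ, δ = min (d / 2) 1 := ⟨_, rfl⟩
  have hδ0 : 0 < δ := hδ ▸ lt_min (by positivity) one_pos
  refine summable_of_sum_le (c := δ⁻¹ * Real.exp (d ^ 2) * C * (N + 1) / (2 * Real.pi))
    (fun _ => norm_nonneg _) fun s => ?_
  have hfar : ∀ᶠ ε in 𝓝[>] (0 : ℝ), ∀ k ∈ s, |(k : ℝ) * h| ≤ (1 / ε) / 2 := by
    rw [Filter.eventually_all_finset]
    intro k _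
    have : Tendsto (fun ε : ℝ => (1 / ε) / 2) (𝓝[>] 0) atTop := by
      simp only [one_div]
      exact tendsto_inv_nhdsGT_zero.atTop_div_const two_pos
    exact this.eventually_ge_atTop _
  have hε2 : ∀ᶠ ε in 𝓝[>] (0 : ℝ), ε < 1 / 2 := by
    filter_upwards [Ioo_mem_nhdsGT (show (0 : ℝ) < 1 / 2 by norm_num)] with ε hε using hε.2
  have hε0 : ∀ᶠ ε in 𝓝[>] (0 : ℝ), 0 < ε := eventually_mem_nhdsWithin
  obtain ⟨ε, h1, h2, h3, h4⟩ := (hfar.and (hε2.and (hε0.and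
    (hN.eventually_le_const (lt_add_one N))))).exists
  rw [boundaryIntegral_eq_rectNorm] at h4
  obtain ⟨A, hA⟩ : ∃ A, A = 1 / ε := ⟨_, rfl⟩
  obtain ⟨B, hB⟩ : ∃ B, B = d * (1 - ε) := ⟨_, rfl⟩
  rw [← hA] at h1
  rw [← hA, ← hB] at h4
  have hA2 : 2 ≤ A := by
    rw [hA, le_div_iff₀ h3]; linarith
  have hBd : B < d := by rw [hB]; nlinarith
  have hBd2 : d / 2 ≤ B := by rw [hB]; nlinarith
  have hA0 : 0 ≤ A := by linarith
  have hB0 : 0 ≤ B := by linarith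
  have hFc : ContinuousOn F (rectBoundary A B) :=
    hFa.continuousOn.mono (rectBoundary_subset_strip hBd)
  have him : ∀ k : ℤ, ((k * h : ℂ)).im = 0 := by intro k; simp
  have hre : ∀ k : ℤ, ((k * h : ℂ)).re = k * h := by intro k; simp
  have hkA : ∀ k ∈ s, |((k * h : ℂ)).re| < A := fun k hk => by
    rw [hre]; linarith [h1 k hk]
  have hkB : ∀ k : ℤ, |((k * h : ℂ)).im| < B := fun k => by
    rw [him, abs_zero]; linarith
  -- Phases that turn each residue into `|F(kh)|`.
  let σ : ℤ → ℂ := fun k => (starRingEnd ℂ) (F (k * h)) / ‖F (k * h)‖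
  have hσ : ∀ k, ‖σ k‖ ≤ 1 := fun k => by
    simp only [σ, norm_div, RCLike.norm_conj, Complex.norm_real, norm_norm]
    exact div_self_le_one _
  have hσF : ∀ k, σ k * F (k * h) = ‖F (k * h)‖ := fun k => by
    by_cases h0 : F (k * h) = 0
    · simp [σ, h0]
    · have h0' : (‖F (k * h)‖ : ℂ) ≠ 0 := by exact_mod_cast norm_ne_zero_iff.2 h0
      simp only [σ]
      rw [div_mul_eq_mul_div, div_eq_iff h0', mul_comm, Complex.mul_conj']
      ring
  let E : ℤ → ℂ → ℂ := fun k ζ => F ζ * Complex.exp (-(ζ - k * h) ^ 2)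
  have hE : ∀ k, DifferentiableOn ℂ (E k) (strip d) := fun k =>
    hFa.differentiableOn.mul (by fun_prop)
  have hint : rectIntegral (fun ζ => ∑ k ∈ s, σ k * (E k ζ * (ζ - k * h)⁻¹)) A B =
      2 * Real.pi * Complex.I * ((∑ k ∈ s, ‖F (k * h)‖ : ℝ) : ℂ) := by
    rw [rectIntegral_sum s hA0 hB0]
    · rw [Complex.ofReal_sum, Finset.mul_sum]
      refine Finset.sum_congr rfl fun k hk => ?_
      rw [rectIntegral_const_mul, rectIntegral_cauchy (isOpen_strip d) (rect_subset_strip hBd)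
        (hE k) (hkA k hk) (hkB k), ← hσF]
      simp only [E, sub_self]
      simp
      ring
    · intro k hk
      exact continuousOn_const.mul (((hE k).continuousOn.mono (rectBoundary_subset_strip hBd)).mul
        (continuousOn_inv_sub (hkA k hk) (hkB k)))
  have hbound : ∀ ζ ∈ rectBoundary A B, ‖∑ k ∈ s, σ k * (E k ζ * (ζ - k * h)⁻¹)‖ ≤
      (δ⁻¹ * Real.exp (d ^ 2) * C) * ‖F ζ‖ := by
    intro ζ hζ
    have hterm : ∀ k ∈ s, ‖σ k * (E k ζ * (ζ - k * h)⁻¹)‖ ≤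
        (δ⁻¹ * Real.exp (d ^ 2) * ‖F ζ‖) * Real.exp (-(ζ.re - k * h) ^ 2) := by
      intro k hk
      have hdist : δ ≤ ‖ζ - k * h‖ := by
        rcases hζ.2.2 with hr | hi
        · refine le_trans ?_ (Complex.abs_re_le_norm _)
          rw [Complex.sub_re, hre]
          have := abs_sub_abs_le_abs_sub ζ.re (k * h)
          have := h1 k hk
          have : δ ≤ 1 := hδ ▸ min_le_right _ _
          linarith
        · refine le_trans ?_ (Complex.abs_im_le_norm _)
          rw [Complex.sub_im, him, sub_zero, hi]
          have : δ ≤ d / 2 := hδ ▸ min_le_left _ _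
          linarith
      have hexp : ‖Complex.exp (-(ζ - k * h) ^ 2)‖ ≤
          Real.exp (d ^ 2) * Real.exp (-(ζ.re - k * h) ^ 2) := by
        rw [Complex.norm_exp, ← Real.exp_add]
        refine Real.exp_le_exp.2 ?_
        have : (-(ζ - k * h) ^ 2).re = ζ.im ^ 2 + -(ζ.re - k * h) ^ 2 := by
          simp [pow_two]
          ring
        rw [this]
        have : ζ.im ^ 2 ≤ d ^ 2 := sq_le_sq' (by linarith [(abs_le.1 hζ.2.1).1])
          (by linarith [(abs_le.1 hζ.2.1).2])
        linarith
      have hinv : ‖(ζ - k * h)⁻¹‖ ≤ δ⁻¹ := by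
        rw [norm_inv]; exact inv_anti₀ hδ0 hdist
      simp only [E, norm_mul]
      calc ‖σ k‖ * (‖F ζ‖ * ‖Complex.exp (-(ζ - k * h) ^ 2)‖ * ‖(ζ - k * h)⁻¹‖)
          ≤ 1 * (‖F ζ‖ * (Real.exp (d ^ 2) * Real.exp (-(ζ.re - k * h) ^ 2)) * δ⁻¹) := by
            gcongr
            exact hσ k
        _ = _ := by ring
    calc _ ≤ ∑ k ∈ s, (δ⁻¹ * Real.exp (d ^ 2) * ‖F ζ‖) * Real.exp (-(ζ.re - k * h) ^ 2) :=
          norm_sum_le_of_le s hterm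
      _ = (δ⁻¹ * Real.exp (d ^ 2) * ‖F ζ‖) * ∑ k ∈ s, Real.exp (-(ζ.re - k * h) ^ 2) :=
          (Finset.mul_sum _ _ _).symm
      _ ≤ (δ⁻¹ * Real.exp (d ^ 2) * ‖F ζ‖) * C := by
          gcongr
          exact hC _ _
      _ = _ := by ring
  have hfin := norm_rectIntegral_le hA0 hB0 hFc hbound
  rw [hint] at hfin
  have hS0 : 0 ≤ ∑ k ∈ s, ‖F (k * h)‖ := Finset.sum_nonneg fun _ _ => norm_nonneg _
  rw [norm_mul, Complex.norm_real, Real.norm_of_nonneg hS0, norm_mul, norm_mul, Complex.norm_I,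
    Complex.norm_real, Real.norm_of_nonneg Real.pi_pos.le] at hfin
  rw [le_div_iff₀ (by positivity)]
  have : (δ⁻¹ * Real.exp (d ^ 2) * C) * rectNorm F A B ≤
      (δ⁻¹ * Real.exp (d ^ 2) * C) * (N + 1) := by gcongr
  simp at hfin
  linarith

/-! ### Division by simple zeros, Sinc functions and lower bounds for the sine -/

theorem sub_mul_dslope_eq (f : ℂ → ℂ) {c : ℂ} (hc : f c = 0) (z : ℂ) :
    f z = (z - c) * dslope f c z := by
  rw [← smul_eq_mul, sub_smul_dslope, hc, sub_zero]

/-- At a zero `c` of `s` both functions carry a factor `z - c`; the quotient of the two `dslope`s is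
the holomorphic extension, its denominator being nonzero since the zero is simple. -/
theorem exists_differentiableOn_quotient {R s : ℂ → ℂ} {U : Set ℂ} (hU : IsOpen U)
    (hR : DifferentiableOn ℂ R U) (hs : DifferentiableOn ℂ s U)
    (hz : ∀ c ∈ U, s c = 0 → R c = 0 ∧ deriv s c ≠ 0) :
    ∃ P : ℂ → ℂ, DifferentiableOn ℂ P U ∧ ∀ z ∈ U, R z = s z * P z := by
  classical
  let P : ℂ → ℂ := fun z => if s z = 0 then deriv R z / deriv s z else R z / s z
  refine ⟨P, fun c hc => ?_, fun z hzU => ?_⟩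
  · have hcU := hU.mem_nhds hc
    have hsc := hs.differentiableAt hcU
    have hRc := hR.differentiableAt hcU
    refine DifferentiableAt.differentiableWithinAt ?_
    by_cases h0 : s c = 0
    · obtain ⟨hR0, hs'⟩ := hz c hc h0
      have hds := ((Complex.differentiableOn_dslope hcU).2 hs).differentiableAt hcU
      have hdR := ((Complex.differentiableOn_dslope hcU).2 hR).differentiableAt hcU
      have hne : dslope s c c ≠ 0 := by rwa [dslope_same]
      refine (hdR.div hds hne).congr_of_eventuallyEq ?_
      filter_upwards [hds.continuousAt.eventually_ne hne] with z hzne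
      by_cases hzc : z = c
      · subst hzc
        simp [P, h0]
      · have hzc' := sub_ne_zero.2 hzc
        have e1 := sub_mul_dslope_eq s h0 z
        have e2 := sub_mul_dslope_eq R hR0 z
        have hsz : s z ≠ 0 := by rw [e1]; exact mul_ne_zero hzc' hzne
        simp only [P, if_neg hsz, Pi.div_apply]
        rw [e1, e2, mul_div_mul_left _ _ hzc']
    · refine (hRc.div hsc h0).congr_of_eventuallyEq ?_
      filter_upwards [hsc.continuousAt.eventually_ne h0] with z hzne
      simp [P, hzne]
  · by_cases h0 : s z = 0
    · rw [(hz z hzU h0).1, h0, zero_mul]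
    · simp only [P, if_neg h0]
      field_simp

theorem sincFun_eq_dslope {h : ℝ} (hh : h ≠ 0) (k : ℤ) (x : ℂ) :
    sincFun k h x = dslope Complex.sin 0 (Real.pi * (x - k * h) / h) := by
  have hh' : (h : ℂ) ≠ 0 := by exact_mod_cast hh
  have hpi : (Real.pi : ℂ) ≠ 0 := by exact_mod_cast Real.pi_ne_zero
  unfold sincFun
  by_cases hx : x = k * h
  · simp [hx]
  · have hne : (Real.pi * (x - k * h) / h : ℂ) ≠ 0 :=
      div_ne_zero (mul_ne_zero hpi (sub_ne_zero.2 hx)) hh'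
    rw [if_neg hx, dslope_of_ne _ hne, slope_def_field]
    simp

theorem differentiable_dslope_sin : Differentiable ℂ (dslope Complex.sin 0) := by
  rw [← differentiableOn_univ, Complex.differentiableOn_dslope univ_mem]
  exact Complex.differentiable_sin.differentiableOn

theorem differentiable_sincFun {h : ℝ} (hh : h ≠ 0) (k : ℤ) :
    Differentiable ℂ (sincFun k h) := by
  rw [show sincFun k h = _ from funext (sincFun_eq_dslope hh k)]
  exact differentiable_dslope_sin.comp (by fun_prop)

/-- All Sinc functions share the factor `sin(πx/h)`, so dividing an expansion by it leaves simple
fractions. -/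
theorem sincFun_of_ne {h : ℝ} (hh : h ≠ 0) (k : ℤ) {x : ℂ} (hx : x ≠ k * h) :
    sincFun k h x =
      Complex.sin (Real.pi * x / h) * (((-1) ^ k * (h / Real.pi)) * (x - k * h)⁻¹) := by
  have hh' : (h : ℂ) ≠ 0 := by exact_mod_cast hh
  have hpi : (Real.pi : ℂ) ≠ 0 := by exact_mod_cast Real.pi_ne_zero
  have hx' := sub_ne_zero.2 hx
  have e : (Real.pi * (x - k * h) / h : ℂ) = Real.pi * x / h - k * Real.pi := by
    field_simp
  rw [sincFun, if_neg hx, e, Complex.sin_antiperiodic.sub_int_mul_eq, ← e, Int.cast_negOnePow]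
  field_simp

theorem sincFun_int {h : ℝ} (hh : h ≠ 0) (k l : ℤ) :
    sincFun k h (l * h) = if k = l then 1 else 0 := by
  have hh' : (h : ℂ) ≠ 0 := by exact_mod_cast hh
  by_cases hkl : k = l
  · simp [sincFun, hkl]
  · have hne : (l * h : ℂ) ≠ k * h := fun e =>
      hkl (by exact_mod_cast (mul_right_cancel₀ hh' e).symm)
    rw [sincFun_of_ne hh k hne, if_neg hkl,
      show (Real.pi * (l * h) / h : ℂ) = l * Real.pi by field_simp, Complex.sin_int_mul_pi,
      zero_mul]

theorem eq_int_mul_of_sin_eq_zero {h : ℝ} (hh : h ≠ 0) {z : ℂ}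
    (hz : Complex.sin (Real.pi * z / h) = 0) : ∃ k : ℤ, z = k * h := by
  have hh' : (h : ℂ) ≠ 0 := by exact_mod_cast hh
  have hpi : (Real.pi : ℂ) ≠ 0 := by exact_mod_cast Real.pi_ne_zero
  obtain ⟨k, hk⟩ := Complex.sin_eq_zero_iff.1 hz
  refine ⟨k, ?_⟩
  field_simp at hk
  rw [hk, mul_comm]

theorem normSq_sin (z : ℂ) :
    ‖Complex.sin z‖ ^ 2 = Real.sin z.re ^ 2 + Real.sinh z.im ^ 2 := by
  have e : Complex.sin z = (Real.sin z.re * Real.cosh z.im : ℝ) +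
      (Real.cos z.re * Real.sinh z.im : ℝ) * Complex.I := by
    rw [Complex.sin_eq]; push_cast; ring
  rw [e, ← Complex.normSq_eq_norm_sq, Complex.normSq_add_mul_I]
  have h1 := Real.sin_sq_add_cos_sq z.re
  have h2 := Real.cosh_sq z.im
  linear_combination Real.sin z.re ^ 2 * h2 + Real.sinh z.im ^ 2 * h1

theorem sinh_le_norm_sin {z : ℂ} {y : ℝ} (hz : |z.im| = y) : Real.sinh y ≤ ‖Complex.sin z‖ := by
  refine (abs_le_of_sq_le_sq' ?_ (norm_nonneg _)).2
  have : Real.sinh y ^ 2 = Real.sinh z.im ^ 2 := by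
    rw [← hz, ← Real.abs_sinh, sq_abs]
  rw [normSq_sin, this]
  linarith [sq_nonneg (Real.sin z.re)]

theorem one_le_norm_sin {z : ℂ} {N : ℕ} (hz : |z.re| = (N + 1 / 2) * Real.pi) :
    1 ≤ ‖Complex.sin z‖ := by
  have h1 : Real.cos z.re = 0 := by
    rw [← Real.cos_abs, hz, Real.cos_eq_zero_iff]
    exact ⟨N, by push_cast; ring⟩
  have h2 := Real.sin_sq_add_cos_sq z.re
  rw [h1] at h2
  have h3 := normSq_sin z
  nlinarith [sq_nonneg (Real.sinh z.im), norm_nonneg (Complex.sin z)]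

/-! ### The truncated remainder and its quotient by the sine -/

/-- The error of the truncated Sinc interpolation of `F`. -/
def sincRemainder (F : ℂ → ℂ) (h : ℝ) (N : ℕ) (z : ℂ) : ℂ :=
  F z - ∑ k ∈ Finset.Icc (-N : ℤ) N, F (k * h) * sincFun k h z

/-- The rectangle `|Re z| < (N + 1) h` of the strip. -/
def cutStrip (d h : ℝ) (N : ℕ) : Set ℂ := {z | |z.re| < (N + 1) * h ∧ |z.im| < d}

theorem isOpen_cutStrip (d h : ℝ) (N : ℕ) : IsOpen (cutStrip d h N) :=
  (isOpen_lt (f := fun z : ℂ => |z.re|) (by fun_prop) continuous_const).inter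
    (isOpen_lt (f := fun z : ℂ => |z.im|) (by fun_prop) continuous_const)

theorem pi_mul_div_re (z : ℂ) (h : ℝ) : (Real.pi * z / h : ℂ).re = Real.pi * z.re / h := by
  rw [Complex.div_ofReal_re, Complex.re_ofReal_mul]

theorem pi_mul_div_im (z : ℂ) (h : ℝ) : (Real.pi * z / h : ℂ).im = Real.pi * z.im / h := by
  rw [Complex.div_ofReal_im, Complex.im_ofReal_mul]

section

variable {d h B : ℝ} {N : ℕ} {F : ℂ → ℂ}

theorem differentiable_sin_scaled :
    Differentiable ℂ fun z : ℂ => Complex.sin (Real.pi * z / h) :=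
  Complex.differentiable_sin.comp (by fun_prop)

theorem norm_sin_boundary (hh : 0 < h) {ζ : ℂ}
    (hζ : ζ ∈ rectBoundary ((N + 1 / 2) * h) B) :
    (|ζ.re| = (N + 1 / 2) * h ∧ 1 ≤ ‖Complex.sin (Real.pi * ζ / h)‖) ∨
    (|ζ.im| = B ∧ Real.sinh (Real.pi * B / h) ≤ ‖Complex.sin (Real.pi * ζ / h)‖) := by
  rcases hζ.2.2 with hr | hi
  · refine Or.inl ⟨hr, one_le_norm_sin (N := N) ?_⟩
    rw [pi_mul_div_re, abs_div, abs_mul, hr, abs_of_pos hh, abs_of_pos Real.pi_pos]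
    field_simp
  · refine Or.inr ⟨hi, sinh_le_norm_sin ?_⟩
    rw [pi_mul_div_im, abs_div, abs_mul, hi, abs_of_pos hh, abs_of_pos Real.pi_pos]

theorem sin_boundary_ne_zero (hh : 0 < h) (hB : 0 < B) {ζ : ℂ}
    (hζ : ζ ∈ rectBoundary ((N + 1 / 2) * h) B) : Complex.sin (Real.pi * ζ / h) ≠ 0 := by
  have hs : 0 < Real.sinh (Real.pi * B / h) := Real.sinh_pos_iff.2 (by positivity)
  refine norm_pos_iff.1 ?_
  rcases norm_sin_boundary hh hζ with h1 | h1 <;> linarith [h1.2]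

theorem exists_sincRemainder_factor (hh : 0 < h)
    (hF : DifferentiableOn ℂ F (strip d)) :
    ∃ P : ℂ → ℂ, DifferentiableOn ℂ P (cutStrip d h N) ∧
      (∀ z ∈ cutStrip d h N,
        sincRemainder F h N z = Complex.sin (Real.pi * z / h) * P z) := by
  refine exists_differentiableOn_quotient (isOpen_cutStrip d h N) ?_
    differentiable_sin_scaled.differentiableOn fun c hc h0 => ⟨?_, ?_⟩
  · refine (hF.mono fun z hz => hz.2).sub ?_
    exact DifferentiableOn.fun_sum fun k _ =>
      ((differentiable_sincFun hh.ne' k).const_mul _).differentiableOn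
  -- The width `(N + 1)h` is chosen so that the zeros of the sine in the open rectangle are exactly
  -- the nodes with `|l| ≤ N`.
  · obtain ⟨l, rfl⟩ := eq_int_mul_of_sin_eq_zero hh.ne' h0
    have hl := hc.1
    have e : ((l * h : ℂ)).re = l * h := by simp
    rw [e, abs_mul, abs_of_pos hh] at hl
    have hl' : |(l : ℝ)| < N + 1 := lt_of_mul_lt_mul_right hl hh.le
    have hl2 : |l| < N + 1 := by exact_mod_cast hl'
    have hmem : l ∈ Finset.Icc (-N : ℤ) N := by
      rw [Finset.mem_Icc]; rw [abs_lt] at hl2; omega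
    simp [sincRemainder, sincFun_int hh.ne', hmem]
  · have hd1 : HasDerivAt (fun z : ℂ => Complex.sin (Real.pi * z / h))
        (Complex.cos (Real.pi * c / h) * (Real.pi / h)) c := by
      have : HasDerivAt (fun z : ℂ => Real.pi * z / h) (Real.pi / h : ℂ) c := by
        simpa using ((hasDerivAt_id c).const_mul (Real.pi : ℂ)).div_const (h : ℂ)
      exact this.csin
    rw [hd1.deriv]
    refine mul_ne_zero (fun hc0 => ?_) (div_ne_zero (by exact_mod_cast Real.pi_ne_zero)
      (by exact_mod_cast hh.ne'))
    have := Complex.sin_sq_add_cos_sq (Real.pi * c / h)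
    rw [h0, hc0] at this
    simp at this

theorem rectIntegral_sincRemainder_factor (hh : 0 < h) (hB : 0 < B) (hBd : B < d) {P : ℂ → ℂ}
    (hP : DifferentiableOn ℂ P (cutStrip d h N))
    (hRP : ∀ z ∈ cutStrip d h N, sincRemainder F h N z = Complex.sin (Real.pi * z / h) * P z)
    {z : ℂ} (h1 : |z.re| < (N + 1 / 2) * h) (h2 : |z.im| < B) (hz : ∀ k : ℤ, (k * h : ℂ) ≠ z) :
    rectIntegral (fun ζ => F ζ / Complex.sin (Real.pi * ζ / h) * (ζ - z)⁻¹)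
      ((N + 1 / 2) * h) B = 2 * Real.pi * Complex.I * P z := by
  set A := (N + 1 / 2) * h with hA
  have hA0 : 0 ≤ A := by positivity
  have hsub : {z : ℂ | |z.re| ≤ A ∧ |z.im| ≤ B} ⊆ cutStrip d h N := fun ζ hζ =>
    ⟨hζ.1.trans_lt (by rw [hA]; nlinarith), hζ.2.trans_lt hBd⟩
  have hbsub : rectBoundary A B ⊆ cutStrip d h N := fun ζ hζ => hsub ⟨hζ.1, hζ.2.1⟩
  have hk1 : ∀ k ∈ Finset.Icc (-N : ℤ) N, |((k * h : ℂ)).re| < A := by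
    intro k hk
    have e : ((k * h : ℂ)).re = k * h := by simp
    rw [e, abs_mul, abs_of_pos hh, hA]
    have : |k| ≤ N := abs_le.2 (Finset.mem_Icc.1 hk)
    have : |(k : ℝ)| ≤ N := by exact_mod_cast this
    exact mul_lt_mul_of_pos_right (by linarith) hh
  have hk2 : ∀ k : ℤ, |((k * h : ℂ)).im| < B := by intro k; simpa using hB
  -- The residues of `F / sin(πζ/h)` at the nodes.
  let c : ℤ → ℂ := fun k => F (k * h) * ((-1) ^ k * (h / Real.pi))
  have hcont : ∀ k ∈ Finset.Icc (-N : ℤ) N,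
      ContinuousOn (fun ζ : ℂ => c k * ((ζ - k * h)⁻¹ * (ζ - z)⁻¹)) (rectBoundary A B) := fun k hk =>
    continuousOn_const.mul ((continuousOn_inv_sub (hk1 k hk) (hk2 k)).mul
      (continuousOn_inv_sub h1 h2))
  have heq : rectIntegral (fun ζ => F ζ / Complex.sin (Real.pi * ζ / h) * (ζ - z)⁻¹) A B =
      rectIntegral (fun ζ => P ζ * (ζ - z)⁻¹ +
        ∑ k ∈ Finset.Icc (-N : ℤ) N, c k * ((ζ - k * h)⁻¹ * (ζ - z)⁻¹)) A B := by
    refine rectIntegral_congr hA0 hB.le fun ζ hζ => ?_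
    have hs := sin_boundary_ne_zero hh hB hζ
    have e1 := hRP ζ (hbsub hζ)
    have e2 : ∑ k ∈ Finset.Icc (-N : ℤ) N, F (k * h) * sincFun k h ζ =
        Complex.sin (Real.pi * ζ / h) *
          ∑ k ∈ Finset.Icc (-N : ℤ) N, c k * (ζ - k * h)⁻¹ := by
      rw [Finset.mul_sum]
      refine Finset.sum_congr rfl fun k hk => ?_
      rw [sincFun_of_ne hh.ne' k (ne_of_mem_rectBoundary (hk1 k hk) (hk2 k) hζ)]
      simp only [c]
      ring
    rw [sincRemainder, e2] at e1
    have e3 : F ζ / Complex.sin (Real.pi * ζ / h) =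
        P ζ + ∑ k ∈ Finset.Icc (-N : ℤ) N, c k * (ζ - k * h)⁻¹ := by
      rw [div_eq_iff hs]
      linear_combination e1
    simp only [e3, add_mul, Finset.sum_mul, mul_assoc]
  have hPc : ContinuousOn (fun ζ => P ζ * (ζ - z)⁻¹) (rectBoundary A B) :=
    (hP.continuousOn.mono hbsub).mul (continuousOn_inv_sub h1 h2)
  rw [heq, rectIntegral_add hA0 hB.le hPc
      (continuousOn_finsetSum _ hcont), rectIntegral_sum _ hA0 hB.le hcont,
    rectIntegral_cauchy (isOpen_cutStrip d h N) hsub hP h1 h2, Finset.sum_eq_zero, add_zero]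
  intro k hk
  rw [rectIntegral_const_mul, rectIntegral_inv_mul_inv (hz k) h1 h2 (hk1 k hk) (hk2 k), mul_zero]

/-- A point within `d/2` of the real `x` is at least `B - d/2` from the horizontal sides and `A -
|x| - d/2` from the vertical ones, `A = (N + 1/2)h`. The two resulting bounds for the kernel are
added, so that one constant serves on every side. -/
theorem norm_sincRemainder_factor_le_of_ne (hh : 0 < h) (hB : d / 2 < B)
    (hBd : B < d) (hF : DifferentiableOn ℂ F (strip d)) {P : ℂ → ℂ}
    (hP : DifferentiableOn ℂ P (cutStrip d h N))
    (hRP : ∀ z ∈ cutStrip d h N, sincRemainder F h N z = Complex.sin (Real.pi * z / h) * P z)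
    {x : ℝ} (hx : |x| + d / 2 < (N + 1 / 2) * h) {z : ℂ} (hzx : ‖z - x‖ ≤ d / 2)
    (hz : ∀ k : ℤ, (k * h : ℂ) ≠ z) :
    ‖P z‖ ≤ ((Real.sinh (Real.pi * B / h) * (B - d / 2))⁻¹ +
      ((N + 1 / 2) * h - |x| - d / 2)⁻¹) * rectNorm F ((N + 1 / 2) * h) B / (2 * Real.pi) := by
  have hB0 : 0 < B := by linarith
  have hA0 : 0 ≤ (N + 1 / 2) * h := by positivity
  have hs0 : 0 < Real.sinh (Real.pi * B / h) := Real.sinh_pos_iff.2 (by positivity)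
  have hre : |z.re| ≤ |x| + d / 2 := by
    have h1 := Complex.abs_re_le_norm (z - x)
    have h2 := abs_sub_abs_le_abs_sub z.re x
    simp only [Complex.sub_re, Complex.ofReal_re] at h1
    linarith
  have him : |z.im| ≤ d / 2 := by
    have h1 := Complex.abs_im_le_norm (z - x)
    simp only [Complex.sub_im, Complex.ofReal_im, sub_zero] at h1
    linarith
  have hint := rectIntegral_sincRemainder_factor hh hB0 hBd hP hRP (hre.trans_lt hx)
    (him.trans_lt hB) hz
  have hbd := norm_rectIntegral_le (F := F)
    (f := fun ζ => F ζ / Complex.sin (Real.pi * ζ / h) * (ζ - z)⁻¹)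
    (M := (Real.sinh (Real.pi * B / h) * (B - d / 2))⁻¹ + ((N + 1 / 2) * h - |x| - d / 2)⁻¹)
    hA0 hB0.le (hF.continuousOn.mono (rectBoundary_subset_strip hBd)) (by
      intro ζ hζ
      have p1 : 0 < (Real.sinh (Real.pi * B / h) * (B - d / 2))⁻¹ :=
        inv_pos.2 (mul_pos hs0 (by linarith))
      have p2 : 0 < ((N + 1 / 2) * h - |x| - d / 2)⁻¹ := inv_pos.2 (by linarith)
      rw [div_mul_eq_mul_div, mul_div_assoc, norm_mul, mul_comm]
      refine mul_le_mul_of_nonneg_right ?_ (norm_nonneg _)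
      rw [norm_div, norm_inv, div_eq_mul_inv, ← mul_inv, mul_comm]
      rcases norm_sin_boundary hh hζ with ⟨hr, hs⟩ | ⟨hi, hs⟩
      · have : (N + 1 / 2) * h - |x| - d / 2 ≤ ‖ζ - z‖ := by
          refine le_trans ?_ (Complex.abs_re_le_norm _)
          have := abs_sub_abs_le_abs_sub ζ.re z.re
          rw [Complex.sub_re]
          linarith
        have : ((N + 1 / 2) * h - |x| - d / 2) ≤
            ‖Complex.sin (Real.pi * ζ / h)‖ * ‖ζ - z‖ := by
          nlinarith [norm_nonneg (ζ - z)]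
        have := inv_anti₀ (by linarith) this
        linarith
      · have : B - d / 2 ≤ ‖ζ - z‖ := by
          refine le_trans ?_ (Complex.abs_im_le_norm _)
          have := abs_sub_abs_le_abs_sub ζ.im z.im
          rw [Complex.sub_im]
          linarith
        have := inv_anti₀ (mul_pos hs0 (by linarith))
          (mul_le_mul hs this (by linarith) (norm_nonneg _))
        linarith)
  rw [hint, norm_mul, norm_mul, norm_mul, Complex.norm_I, Complex.norm_real,
    Real.norm_of_nonneg Real.pi_pos.le] at hbd
  rw [le_div_iff₀ (by positivity)]
  simp at hbd ⊢
  linarith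

/-- The integral formula excludes the nodes; they are reached by continuity of `P` along `kh + iη`,
`η → 0+`, which avoids the real axis. -/
theorem norm_sincRemainder_factor_le (hh : 0 < h) (hd : 0 < d) (hB : d / 2 < B)
    (hBd : B < d) (hF : DifferentiableOn ℂ F (strip d)) {P : ℂ → ℂ}
    (hP : DifferentiableOn ℂ P (cutStrip d h N))
    (hRP : ∀ z ∈ cutStrip d h N, sincRemainder F h N z = Complex.sin (Real.pi * z / h) * P z)
    {x : ℝ} (hx : |x| + d / 2 < (N + 1 / 2) * h) {z : ℂ} (hzx : ‖z - x‖ < d / 2) :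
    ‖P z‖ ≤ ((Real.sinh (Real.pi * B / h) * (B - d / 2))⁻¹ +
      ((N + 1 / 2) * h - |x| - d / 2)⁻¹) * rectNorm F ((N + 1 / 2) * h) B / (2 * Real.pi) := by
  by_cases hz : ∀ k : ℤ, (k * h : ℂ) ≠ z
  · exact norm_sincRemainder_factor_le_of_ne hh hB hBd hF hP hRP hx hzx.le hz
  push Not at hz
  obtain ⟨k, rfl⟩ := hz
  have hmem : (k * h : ℂ) ∈ cutStrip d h N := by
    refine ⟨?_, by simpa using hd⟩
    have h1 := Complex.abs_re_le_norm (k * h - x : ℂ)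
    have h2 := abs_sub_abs_le_abs_sub (k * h : ℂ).re x
    simp only [Complex.sub_re, Complex.ofReal_re] at h1
    nlinarith
  have hcont : ContinuousAt P (k * h) :=
    (hP.differentiableAt ((isOpen_cutStrip d h N).mem_nhds hmem)).continuousAt
  have hpath : Tendsto (fun η : ℝ => (k * h + η * Complex.I : ℂ)) (𝓝[>] 0) (𝓝 (k * h)) := by
    have : Continuous fun η : ℝ => (k * h + η * Complex.I : ℂ) := by fun_prop
    have := this.tendsto 0
    simp only [Complex.ofReal_zero, zero_mul, add_zero] at this
    exact this.mono_left nhdsWithin_le_nhds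
  refine le_of_tendsto (hcont.tendsto.comp hpath).norm ?_
  have hnear : ∀ᶠ w : ℂ in 𝓝 (k * h : ℂ), ‖w - x‖ < d / 2 :=
    (isOpen_lt (by fun_prop) continuous_const).mem_nhds hzx
  filter_upwards [hpath.eventually hnear, self_mem_nhdsWithin] with η h1 h2
  refine norm_sincRemainder_factor_le_of_ne hh hB hBd hF hP hRP hx h1.le fun l hl => ?_
  have := congrArg Complex.im hl
  simp at this
  exact (ne_of_gt h2) this.symm

theorem norm_iteratedDeriv_sincRemainder_factor_le (hh : 0 < h) (hd : 0 < d) (hB : d / 2 < B)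
    (hBd : B < d) (hF : DifferentiableOn ℂ F (strip d)) {P : ℂ → ℂ}
    (hP : DifferentiableOn ℂ P (cutStrip d h N))
    (hRP : ∀ z ∈ cutStrip d h N, sincRemainder F h N z = Complex.sin (Real.pi * z / h) * P z)
    {x : ℝ} (hx : |x| + d / 2 < (N + 1 / 2) * h) (p : ℕ) :
    ‖iteratedDeriv p P x‖ ≤ p.factorial * (((Real.sinh (Real.pi * B / h) * (B - d / 2))⁻¹ +
      ((N + 1 / 2) * h - |x| - d / 2)⁻¹) * rectNorm F ((N + 1 / 2) * h) B / (2 * Real.pi)) /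
      (d / 4) ^ p := by
  refine Complex.norm_iteratedDeriv_le_of_forall_mem_sphere_norm_le p (by positivity) ?_ ?_
  · refine DifferentiableOn.diffContOnCl (hP.mono fun z hz => ?_)
    have hz' := Metric.closure_ball_subset_closedBall hz
    rw [Metric.mem_closedBall, dist_eq_norm] at hz'
    have h1 := Complex.abs_re_le_norm (z - x)
    have h2 := abs_sub_abs_le_abs_sub z.re x
    have h3 := Complex.abs_im_le_norm (z - x)
    simp only [Complex.sub_re, Complex.ofReal_re, Complex.sub_im, Complex.ofReal_im,
      sub_zero] at h1 h3
    exact ⟨by nlinarith, by linarith⟩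
  · intro z hz
    rw [mem_sphere_iff_norm] at hz
    exact norm_sincRemainder_factor_le hh hd hB hBd hF hP hRP hx (by linarith)

/-- The height `d(1 - 1/A)` turns `rectNorm` into `boundaryIntegral` at `ε = 1/A`; the contribution
of the vertical sides vanishes. -/
theorem tendsto_sincRemainder_factor_bound (hh : 0 < h) (hd : 0 < d) {n : ℝ}
    (hn : Tendsto (boundaryIntegral F d) (𝓝[>] 0) (𝓝 n)) (x : ℝ) :
    Tendsto (fun N : ℕ =>
      ((Real.sinh (Real.pi * (d * (1 - 1 / ((N + 1 / 2) * h))) / h) *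
        (d * (1 - 1 / ((N + 1 / 2) * h)) - d / 2))⁻¹ +
      ((N + 1 / 2) * h - |x| - d / 2)⁻¹) *
        rectNorm F ((N + 1 / 2) * h) (d * (1 - 1 / ((N + 1 / 2) * h))) / (2 * Real.pi)) atTop
      (𝓝 ((Real.sinh (Real.pi * d / h) * (d / 2))⁻¹ * n / (2 * Real.pi))) := by
  have hA : Tendsto (fun N : ℕ => ((N : ℝ) + 1 / 2) * h) atTop atTop :=
    (tendsto_atTop_add_const_right _ _ tendsto_natCast_atTop_atTop).atTop_mul_const hh
  have hε : Tendsto (fun N : ℕ => 1 / (((N : ℝ) + 1 / 2) * h)) atTop (𝓝[>] 0) := by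
    simp only [one_div]
    exact tendsto_inv_atTop_nhdsGT_zero.comp (by simpa [one_div] using hA)
  have hB : Tendsto (fun N : ℕ => d * (1 - 1 / (((N : ℝ) + 1 / 2) * h))) atTop (𝓝 d) := by
    simpa using ((hε.mono_right nhdsWithin_le_nhds).const_sub 1).const_mul d
  have hs0 : 0 < Real.sinh (Real.pi * d / h) := Real.sinh_pos_iff.2 (by positivity)
  have hnorm : Tendsto (fun N : ℕ =>
      rectNorm F ((N + 1 / 2) * h) (d * (1 - 1 / ((N + 1 / 2) * h)))) atTop (𝓝 n) := by
    refine (hn.comp hε).congr fun N => ?_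
    simp only [Function.comp, boundaryIntegral_eq_rectNorm, one_div_one_div]
  have h1 : Tendsto (fun N : ℕ =>
      (Real.sinh (Real.pi * (d * (1 - 1 / (((N : ℝ) + 1 / 2) * h))) / h) *
        (d * (1 - 1 / ((N + 1 / 2) * h)) - d / 2))⁻¹) atTop
      (𝓝 ((Real.sinh (Real.pi * d / h) * (d / 2))⁻¹)) := by
    have hs : Continuous fun y : ℝ => Real.sinh (Real.pi * y / h) * (y - d / 2) := by fun_prop
    have := (hs.tendsto d).comp hB
    rw [show d - d / 2 = d / 2 by ring] at this
    exact this.inv₀ (by positivity)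
  have h2 : Tendsto (fun N : ℕ => (((N : ℝ) + 1 / 2) * h - |x| - d / 2)⁻¹) atTop (𝓝 0) := by
    refine tendsto_inv_atTop_zero.comp ?_
    simp only [sub_eq_add_neg]
    exact tendsto_atTop_add_const_right _ _ (tendsto_atTop_add_const_right _ _ hA)
  simpa using ((h1.add h2).mul hnorm).div_const (2 * Real.pi)

/-- Uniformity in `k` is the point. The mean value inequality bounds the Sinc functions by
`exp(π/h)` on `|Im z| ≤ 1`, and Cauchy's estimate on unit circles does the rest. The dependence of
`M` on `h` is harmless, as it serves only for convergence. -/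
theorem exists_norm_sincFun_iteratedDeriv_le (hh : 0 < h) (x : ℝ) (m : ℕ) :
    ∃ M : ℝ, ∀ k : ℤ, ∀ p ≤ m, ‖iteratedDeriv p (sincFun k h) x‖ ≤ M := by
  have hcos : ∀ w : ℂ, ‖Complex.cos w‖ ≤ Real.exp |w.im| := by
    intro w
    rw [Complex.cos, norm_div, Complex.norm_ofNat, div_le_iff₀ two_pos]
    refine (norm_add_le _ _).trans ?_
    rw [Complex.norm_exp, Complex.norm_exp]
    have h1 : (w * Complex.I).re ≤ |w.im| := by simpa using neg_le_abs w.im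
    have h2 : (-w * Complex.I).re ≤ |w.im| := by simpa using le_abs_self w.im
    linarith [Real.exp_le_exp.2 h1, Real.exp_le_exp.2 h2]
  have hsinc : ∀ (k : ℤ) (z : ℂ), |z.im| ≤ 1 → ‖sincFun k h z‖ ≤ Real.exp (Real.pi / h) := by
    intro k z hz
    rw [sincFun_eq_dslope hh.ne']
    set w : ℂ := Real.pi * (z - k * h) / h with hw
    have hwim : |w.im| ≤ Real.pi / h := by
      have : w.im = Real.pi * z.im / h := by
        rw [hw, pi_mul_div_im]; simp
      rw [this, abs_div, abs_mul, abs_of_pos hh, abs_of_pos Real.pi_pos]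
      gcongr
      nlinarith [Real.pi_pos]
    by_cases h0 : w = 0
    · rw [h0, dslope_same]
      simp
      positivity
    · have hconv : Convex ℝ {v : ℂ | |v.im| ≤ Real.pi / h} := by
        have : {v : ℂ | |v.im| ≤ Real.pi / h} =
            Complex.imLm ⁻¹' Set.Icc (-(Real.pi / h)) (Real.pi / h) := by
          ext v; simp [abs_le]
        rw [this]
        exact (convex_Icc _ _).linear_preimage Complex.imLm
      have := hconv.norm_image_sub_le_of_norm_deriv_le (𝕜 := ℂ) (f := Complex.sin)
        (C := Real.exp (Real.pi / h)) (x := 0) (y := w)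
        (fun v _ => Complex.differentiable_sin v)
        (fun v hv => by
          rw [Complex.deriv_sin]
          exact (hcos v).trans (Real.exp_le_exp.2 hv))
        (by simp; positivity) hwim
      rw [dslope_of_ne _ h0, slope_def_field, norm_div, div_le_iff₀ (by simpa using h0)]
      exact this
  refine ⟨∑ p ∈ Finset.range (m + 1), (p.factorial * Real.exp (Real.pi / h) / 1 ^ p : ℝ),
    fun k p hp => ?_⟩
  refine le_trans (Complex.norm_iteratedDeriv_le_of_forall_mem_sphere_norm_le p one_pos
    (differentiable_sincFun hh.ne' k).diffContOnCl fun z hz => hsinc k z ?_) ?_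
  · rw [mem_sphere_iff_norm] at hz
    have h3 := Complex.abs_im_le_norm (z - x)
    simp only [Complex.sub_im, Complex.ofReal_im, sub_zero] at h3
    linarith
  · exact Finset.single_le_sum
      (f := fun p : ℕ => (p.factorial * Real.exp (Real.pi / h) / 1 ^ p : ℝ))
      (fun _ _ => by positivity) (Finset.mem_range.2 (Nat.lt_succ_of_le hp))

end

/-! ### The inverse map and the sine form of the derivative bound -/

theorem isOpen_openInterval (a b : EReal) : IsOpen (openInterval a b) :=
  (isOpen_lt continuous_const continuous_coe_real_ereal).inter
    (isOpen_lt continuous_coe_real_ereal continuous_const)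

theorem real_mem_strip {d : ℝ} (hd : 0 < d) (x : ℝ) : (x : ℂ) ∈ strip d := by
  simpa [strip] using hd

/-- The analytic local inverse takes values in `U` near `φ x`, and injectivity identifies it with
the global one. -/
theorem IsConformalOnto.analyticAt_invFunOn {φ : ℂ → ℂ} {U V : Set ℂ} (hU : IsOpen U)
    (hφ : IsConformalOnto φ U V) {x : ℂ} (hx : x ∈ U) :
    AnalyticAt ℂ (Function.invFunOn φ U) (φ x) := by
  have hleft : ∀ w ∈ U, Function.invFunOn φ U (φ w) = w := fun w hw =>
    hφ.bijOn.injOn.leftInvOn_invFunOn hw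
  have hφx := hφ.analytic x hx
  have hne := hφ.deriv_ne_zero x hx
  have hloc := hφx.analyticAt_localInverse hne
  refine hloc.congr ?_
  have hr := hφx.hasStrictDerivAt.eventually_right_inverse hne
  have hlx : HasStrictDerivAt.localInverse φ (deriv φ x) x hφx.hasStrictDerivAt hne (φ x) = x :=
    HasStrictFDerivAt.localInverse_apply_image ..
  have hmem := hloc.continuousAt.eventually (by rw [hlx]; exact hU.mem_nhds hx)
  filter_upwards [hr, hmem] with w h1 h2
  conv_rhs => rw [← h1]
  exact (hleft _ h2).symm

variable {d : ℝ} {φ : ℂ → ℂ} {D : Set ℂ}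

theorem inverseOn_apply (hφ : IsConformalOnto φ (strip d) D) {x : ℂ} (hx : x ∈ strip d) {t : ℝ}
    (ht : φ x = t) : inverseOn φ (strip d) t = x := by
  rw [inverseOn, ← ht]
  exact hφ.bijOn.injOn.leftInvOn_invFunOn hx

theorem contDiffAt_inverseOn (hφ : IsConformalOnto φ (strip d) D) {x : ℂ} (hx : x ∈ strip d)
    {t : ℝ} (ht : φ x = t) : ContDiffAt ℝ (⊤ : ℕ∞) (inverseOn φ (strip d)) t := by
  have h := hφ.analyticAt_invFunOn (isOpen_strip d) hx
  rw [ht] at h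
  have h2 : ContDiffAt ℝ (⊤ : ℕ∞) (Function.invFunOn φ (strip d)) (t : ℂ) :=
    h.contDiffAt.restrict_scalars ℝ
  exact h2.comp t Complex.ofRealCLM.contDiff.contDiffAt

theorem sin_eq_exp_sub (s : ℝ) (z : ℂ) : Complex.sin (s * z) =
    (2 * Complex.I)⁻¹ * (Complex.exp (Complex.I * s * z) -
      Complex.exp (Complex.I * (-s : ℝ) * z)) := by
  have e1 : Complex.I * s * z = s * z * Complex.I := by ring
  have e2 : Complex.I * (-s : ℝ) * z = -(s * z) * Complex.I := by push_cast; ring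
  rw [e1, e2, Complex.sin, mul_inv, Complex.inv_I]
  ring

/-- Only the extreme values `s = ±π/h` enter; the factor `1/2` in the sine compensates for the two
terms, so the constant is unchanged. -/
theorem DerivBound.multiset_sin {g : ℂ → ℂ} {ψ : ℝ → ℂ} {a b : EReal} {m : ℕ} {C h : ℝ}
    (hh : 0 < h) (hD : DerivBound g ψ a b m C h) {j : ℕ} (hj : j ≤ m) {S : Multiset ℕ}
    (hS : ∀ l ∈ S, 1 ≤ l) (hSj : S.sum = j) {t : ℝ} (ht : t ∈ openInterval a b)
    (hg : ContDiffAt ℝ m (fun τ : ℝ => g τ) t) (hψ : ContDiffAt ℝ m ψ t) :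
    ‖iteratedDeriv (m - j) (fun τ : ℝ => g τ * Complex.sin (Real.pi * ψ τ / h)) t‖ *
      (S.map fun l => ‖iteratedDeriv l ψ t‖).prod ≤ C * (h ^ m)⁻¹ := by
  have hpi : 0 ≤ Real.pi / h := by positivity
  have b1 := hD.multiset hj hS hSj ht (s := Real.pi / h) ⟨by linarith, le_rfl⟩
  have b2 := hD.multiset hj hS hSj ht (s := -(Real.pi / h)) ⟨le_rfl, by linarith⟩
  have hc : ∀ s : ℝ, ContDiffAt ℝ (m - j : ℕ)
      (fun τ : ℝ => g τ * Complex.exp (Complex.I * s * ψ τ)) t := fun s =>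
    (hg.mul (contDiffAt_const.mul hψ).cexp).of_le (by exact_mod_cast Nat.sub_le m j)
  have e : (fun τ : ℝ => g τ * Complex.sin (Real.pi * ψ τ / h)) = fun τ : ℝ =>
      (2 * Complex.I)⁻¹ * (g τ * Complex.exp (Complex.I * (Real.pi / h : ℝ) * ψ τ) -
        g τ * Complex.exp (Complex.I * (-(Real.pi / h) : ℝ) * ψ τ)) := by
    funext τ
    rw [show (Real.pi * ψ τ / h : ℂ) = (Real.pi / h : ℝ) * ψ τ by push_cast; ring, sin_eq_exp_sub]
    ring
  rw [e, iteratedDeriv_const_mul_field, iteratedDeriv_fun_sub (hc _) (hc _), norm_mul]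
  have hprod : 0 ≤ (S.map fun l => ‖iteratedDeriv l ψ t‖).prod :=
    Multiset.prod_map_nonneg fun _ _ => norm_nonneg _
  have h2 : ‖(2 * Complex.I)⁻¹‖ = 1 / 2 := by simp
  rw [h2]
  have := mul_le_mul_of_nonneg_right (norm_sub_le
    (iteratedDeriv (m - j) (fun τ : ℝ => g τ *
      Complex.exp (Complex.I * (Real.pi / h : ℝ) * ψ τ)) t)
    (iteratedDeriv (m - j) (fun τ : ℝ => g τ *
      Complex.exp (Complex.I * (-(Real.pi / h) : ℝ) * ψ τ)) t)) hprod
  linarith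

end SincDeriv

end

/-! ### Assembly of the theorem -/

open SincDeriv in
theorem mainTheorem3 (m : ℕ) (d : ℝ) (hd : 0 < d) (a b : EReal) (hab : a < b)
    (D : Set ℂ) (φ : ℂ → ℂ) (hφ : SincDeriv.IsConformalOnto φ (SincDeriv.strip d) D)
    (hreal : ∀ t ∈ SincDeriv.openInterval a b, ∃ x : ℝ, φ (x : ℂ) = (t : ℂ))
    (f g : ℂ → ℂ) (hg0 : ∀ z ∈ D, g z ≠ 0)
    (hg : ContDiffOn ℝ m (fun t : ℝ => g (t : ℂ)) (SincDeriv.openInterval a b))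
    (F : ℂ → ℂ) (hFdef : ∀ ζ ∈ SincDeriv.strip d, F ζ = f (φ ζ) / g (φ ζ))
    (hF : F ∈ SincDeriv.hardyH1 d) :
    ContDiffOn ℝ m (fun t : ℝ => f (t : ℂ)) (SincDeriv.openInterval a b) ∧
    ∀ C₁ : ℝ, 0 < C₁ → ∃ C₂ : ℝ, ∀ h : ℝ, 0 < h →
      SincDeriv.DerivBound g (SincDeriv.inverseOn φ (SincDeriv.strip d)) a b m C₁ h →
      ∀ t ∈ SincDeriv.openInterval a b,
        Summable (fun k : ℤ => f (φ (k * h)) / g (φ (k * h)) *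
          iteratedDeriv m (fun τ : ℝ => g τ *
            SincDeriv.sincFun k h (SincDeriv.inverseOn φ (SincDeriv.strip d) τ)) t) ∧
        ‖iteratedDeriv m (fun τ : ℝ => f (τ : ℂ)) t -
          ∑' k : ℤ, f (φ (k * h)) / g (φ (k * h)) *
            iteratedDeriv m (fun τ : ℝ => g τ *
              SincDeriv.sincFun k h (SincDeriv.inverseOn φ (SincDeriv.strip d) τ)) t‖
          ≤ C₂ * SincDeriv.hardyNorm F d / (h ^ m * Real.sinh (Real.pi * d / h)) := by
  set ψ := inverseOn φ (strip d) with hψdef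
  have hopen := isOpen_openInterval a b
  have hψreal : ∀ t ∈ openInterval a b, ∃ x : ℝ, ψ t = x ∧ φ x = t := fun t ht => by
    obtain ⟨x, hx⟩ := hreal t ht
    exact ⟨x, inverseOn_apply hφ (real_mem_strip hd x) hx, hx⟩
  have hψsm : ∀ t ∈ openInterval a b, ContDiffAt ℝ (⊤ : ℕ∞) ψ t := fun t ht => by
    obtain ⟨x, hx⟩ := hreal t ht
    exact contDiffAt_inverseOn hφ (real_mem_strip hd x) hx
  have hgsm : ∀ t ∈ openInterval a b, ContDiffAt ℝ m (fun t : ℝ => g (t : ℂ)) t := fun t ht =>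
    hg.contDiffAt (hopen.mem_nhds ht)
  have hfg : ∀ t ∈ openInterval a b, f (t : ℂ) = g t * F (ψ t) := fun t ht => by
    obtain ⟨x, hx, hxt⟩ := hψreal t ht
    have hxs := real_mem_strip hd x
    have hgt : g (t : ℂ) ≠ 0 := hxt ▸ hg0 _ (hφ.bijOn.mapsTo hxs)
    rw [hx, hFdef x hxs, hxt]
    field_simp
  have hFψ : ∀ t ∈ openInterval a b, ContDiffAt ℝ m (fun τ : ℝ => g τ * F (ψ τ)) t := fun t ht => by
    obtain ⟨x, hx, -⟩ := hψreal t ht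
    have hFa : AnalyticAt ℂ F (ψ t) := hF.1 _ (hx ▸ real_mem_strip hd x)
    exact (hgsm t ht).mul
      ((hFa.contDiffAt.restrict_scalars ℝ).comp t ((hψsm t ht).of_le (by exact_mod_cast le_top)))
  have hfev : ∀ t ∈ openInterval a b,
      (fun τ : ℝ => f (τ : ℂ)) =ᶠ[𝓝 t] fun τ : ℝ => g τ * F (ψ τ) := fun t ht => by
    filter_upwards [hopen.mem_nhds ht] with τ hτ using hfg τ hτ
  refine ⟨fun t ht => ((hFψ t ht).congr_of_eventuallyEq (hfev t ht)).contDiffWithinAt, ?_⟩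
  intro C₁ hC₁
  obtain ⟨K, hK0, hK⟩ := exists_norm_iteratedDeriv_mul_comp_le m
  obtain ⟨n, hn⟩ := hF.2
  have hn' : hardyNorm F d = n := hn.limUnder_eq
  obtain ⟨κ, hκ⟩ : ∃ κ : ℝ, κ = ∑ p ∈ Finset.range (m + 1), (p.factorial / (d / 4) ^ p : ℝ) :=
    ⟨_, rfl⟩
  have hκp : ∀ p ≤ m, (p.factorial / (d / 4) ^ p : ℝ) ≤ κ := fun p hp => hκ ▸
    Finset.single_le_sum (f := fun p : ℕ => (p.factorial / (d / 4) ^ p : ℝ))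
      (fun _ _ => by positivity) (Finset.mem_range.2 (Nat.lt_succ_of_le hp))
  -- `K` and `κ` depend on `m` and `d` only, hence not on `h`. The factor `1/(πd)` is `(d/2)⁻¹ /
  -- (2π)`: distance to the horizontal sides and Cauchy's formula.
  refine ⟨K * κ * C₁ / (Real.pi * d), fun h hh hD t ht => ?_⟩
  obtain ⟨x, hx, -⟩ := hψreal t ht
  have hkF : ∀ k : ℤ, f (φ (k * h)) / g (φ (k * h)) = F (k * h) := fun k => by
    have : (k * h : ℂ) ∈ strip d := by simpa using real_mem_strip hd (k * h)
    rw [hFdef _ this]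
  simp only [hkF]
  have hS : ∀ k : ℤ, AnalyticAt ℂ (sincFun k h) (ψ t) := fun k =>
    (differentiable_sincFun hh.ne' k).analyticAt _
  have hgS : ∀ k : ℤ, ContDiffAt ℝ m (fun τ : ℝ => g τ * sincFun k h (ψ τ)) t := fun k =>
    (hgsm t ht).mul (((hS k).contDiffAt.restrict_scalars ℝ).comp t
      ((hψsm t ht).of_le (by exact_mod_cast le_top)))
  have hsum : Summable fun k : ℤ =>
      F (k * h) * iteratedDeriv m (fun τ : ℝ => g τ * sincFun k h (ψ τ)) t := by
    obtain ⟨M, hM⟩ := exists_norm_sincFun_iteratedDeriv_le hh x m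
    refine Summable.of_norm_bounded ((summable_samples hd hh hF).mul_right
      (K * M * (C₁ * (h ^ m)⁻¹))) fun k => ?_
    rw [norm_mul]
    refine mul_le_mul_of_nonneg_left ?_ (norm_nonneg _)
    refine hK _ ψ t (hgsm t ht) (hψsm t ht) _ (hS k) M (by rw [hx]; exact hM k) _
      fun j hj S hSp hSj => ?_
    have hpi : 0 ≤ Real.pi / h := by positivity
    -- At `s = 0` the exponential is `1`, and the hypothesis bounds `g` itself.
    simpa using hD.multiset hj hSp hSj ht (s := 0) ⟨by linarith, hpi⟩
  refine ⟨hsum, ?_⟩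
  have hpart : Tendsto (fun N : ℕ => ∑ k ∈ Finset.Icc (-N : ℤ) N,
      F (k * h) * iteratedDeriv m (fun τ : ℝ => g τ * sincFun k h (ψ τ)) t) atTop
      (𝓝 (∑' k : ℤ, F (k * h) * iteratedDeriv m (fun τ : ℝ => g τ * sincFun k h (ψ τ)) t)) :=
    hsum.hasSum.comp Finset.tendsto_Icc_neg
  have hbound := ((tendsto_sincRemainder_factor_bound hh hd hn x).const_mul (K * κ)).mul_const
    (C₁ * (h ^ m)⁻¹)
  have hlim := le_of_tendsto_of_tendsto (hpart.const_sub
    (iteratedDeriv m (fun τ : ℝ => f (τ : ℂ)) t)).norm hbound ?_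
  · refine hlim.trans_eq ?_
    rw [hn']
    have : Real.sinh (Real.pi * d / h) ≠ 0 := (Real.sinh_pos_iff.2 (by positivity)).ne'
    field_simp
  have hA : Tendsto (fun N : ℕ => ((N : ℝ) + 1 / 2) * h) atTop atTop :=
    (tendsto_atTop_add_const_right _ _ tendsto_natCast_atTop_atTop).atTop_mul_const hh
  -- `A > |x| + d/2` keeps the disc about `x` away from the vertical sides, and `A > 2` gives `B >
  -- d/2`.
  filter_upwards [hA.eventually_gt_atTop (|x| + d / 2), hA.eventually_gt_atTop 2] with N hN1 hN2
  have hFd := hF.1.differentiableOn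
  obtain ⟨P, hP, hRP⟩ := exists_sincRemainder_factor (N := N) hh hFd
  have hA0 : 0 < ((N : ℝ) + 1 / 2) * h := by linarith
  have hε0 : 0 < 1 / (((N : ℝ) + 1 / 2) * h) := by positivity
  have hε2 : 1 / (((N : ℝ) + 1 / 2) * h) < 1 / 2 := one_div_lt_one_div_of_lt two_pos hN2
  have hB : d / 2 < d * (1 - 1 / ((N + 1 / 2) * h)) := by nlinarith
  have hBd : d * (1 - 1 / ((N + 1 / 2) * h)) < d := by nlinarith
  have hderiv := norm_iteratedDeriv_sincRemainder_factor_le hh hd hB hBd hFd hP hRP hN1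
  set q := ((Real.sinh (Real.pi * (d * (1 - 1 / ((N + 1 / 2) * h))) / h) *
        (d * (1 - 1 / ((N + 1 / 2) * h)) - d / 2))⁻¹ +
      ((N + 1 / 2) * h - |x| - d / 2)⁻¹) *
        rectNorm F ((N + 1 / 2) * h) (d * (1 - 1 / ((N + 1 / 2) * h))) / (2 * Real.pi) with hq
  have hq0 : 0 ≤ q := (norm_nonneg _).trans (by simpa using hderiv 0)
  have hmem : ψ t ∈ cutStrip d h N := by
    rw [hx]
    exact ⟨by simp only [Complex.ofReal_re]; nlinarith, by simpa using hd⟩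
  have hnhds := (isOpen_cutStrip d h N).mem_nhds hmem
  have hPa : AnalyticAt ℂ P (ψ t) := hP.analyticAt hnhds
  have hrem : iteratedDeriv m (fun τ : ℝ => f (τ : ℂ)) t - ∑ k ∈ Finset.Icc (-N : ℤ) N,
      F (k * h) * iteratedDeriv m (fun τ : ℝ => g τ * sincFun k h (ψ τ)) t =
      iteratedDeriv m (fun τ : ℝ => (g τ * Complex.sin (Real.pi * ψ τ / h)) * P (ψ τ)) t := by
    simp only [← iteratedDeriv_const_mul_field]
    rw [(hfev t ht).iteratedDeriv_eq, ← iteratedDeriv_fun_sum fun k _ =>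
        contDiffAt_const.mul (hgS k), ← iteratedDeriv_fun_sub (hFψ t ht)
        (ContDiffAt.sum fun k _ => contDiffAt_const.mul (hgS k))]
    refine Filter.EventuallyEq.iteratedDeriv_eq m ?_
    filter_upwards [(hψsm t ht).continuousAt.eventually hnhds] with τ hτ
    rw [mul_assoc, ← hRP _ hτ, sincRemainder, mul_sub, Finset.mul_sum]
    congr 1
    exact Finset.sum_congr rfl fun k _ => by ring
  rw [hrem, mul_assoc K κ]
  have hψm : ContDiffAt ℝ m ψ t := (hψsm t ht).of_le (by exact_mod_cast le_top)
  -- The sine is kept with `g` as the first factor, where `DerivBound` controls it; only `P` is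
  -- differentiated as a composition.
  refine hK _ ψ t ((hgsm t ht).mul ?_) (hψsm t ht) P hPa (κ * q) (fun p hp => ?_) _
    fun j hj S hSp hSj => hD.multiset_sin hh hj hSp hSj ht (hgsm t ht) hψm
  · exact ((differentiable_sin_scaled.analyticAt _).contDiffAt.restrict_scalars ℝ).comp t hψm
  · rw [hx]
    refine (hderiv p).trans ?_
    rw [mul_div_right_comm]
    exact mul_le_mul_of_nonneg_right (hκp p hp) hq0
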